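/- **Setting.** Let $\Theta\subseteq\mathbb R$ be an interval with its usual order, and let $(\Omega,\mathcal A,(P_\theta=p_\theta\mu)_{\theta\in\Theta})$ be a dominated statistical model (each $p_\theta\ge 0$ is a probability density with respect to the measure $\mu$) with monotone likelihood ratio in a real statistic $T$: for all $\theta'<\theta''$ in $\Theta$ there is a nondecreasing $h:\mathbb R\to[0,+\infty]$ with $p_{\theta''}/p_{\theta'}=h(T)$ outside $\{p_{\theta'}=p_{\theta''}=0\}$. "For almost every $\omega$" means outside a set that is negligible for every $P_\theta$; "for almost every $t\in\mathbb R$" means for $t=T(\omega)$ with almost every $\omega$. *Unilateral hypotheses.* $\mathcal F$ indexes all ordered partitions $\{\Theta_1^f,\Theta_0^f\}$ of $\Theta$ into two nonempty parts such that every element of $\Theta_1^f$ is smaller than every element of $\Theta_0^f$. For $A\subseteq\Theta$ let $D_i^A$ (resp. $D_s^A$) be the largest lower (resp. upper) half-line of $\mathbb R$ over which, that is, on whose inverse image under $T$, all $p_\theta$, $\theta\in A$, vanish (it may be $\emptyset$ or $\mathbb R$). Let $N$ be the set of $t\in\mathbb R$ such that all $p_\theta$, $\theta\in\Theta$, vanish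 on $T^{-1}(t)$. For each $f$ fix a normalised family of nondecreasing functions $h_{(\theta_0,\theta_1)}:\mathbb R\to[0,+\infty]$, $(\theta_0,\theta_1)\in\Theta_0^f\times\Theta_1^f$: $p_{\theta_0}/p_{\theta_1}=h_{(\theta_0,\theta_1)}(T)$ outside $\{p_{\theta_0}=p_{\theta_1}=0\}$; $h_{(\theta_0,\theta_1)}$ is constant on every interval disjoint from $D_i^{\Theta_0^f}\cup D_s^{\Theta_1^f}$ over which $p_{\theta_0}=p_{\theta_1}=0$; it is $+\infty$ on $D_s^{\Theta_1^f}$ and $0$ on $D_i^{\Theta_0^f}\setminus D_s^{\Theta_1^f}$. *Experts and votes.* Let $F$ be the set of test functions $1_{\{T\in L\}}$, one for each of the lower half-lines $L=\emptyset$, $]-\infty,t[$, $]-\infty,t]$, $\mathbb R$, totally ordered by inclusion of the half-lines and equipped with the order topology. For a given $f\in\mathcal F$, the set $\overline{\Delta_s}$ of experts is the closure in $F$ of the set of all the test functions $1_{\{h_{(\theta_0,\theta_1)}(T)\le 0\}}$, $1_{\{h_{(\theta_0,\theta_1)}(T)<k\}}$, $1_{\{h_{(\theta_0,\theta_1)}(T)\le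 k\}}$ $(0<k<+\infty)$, $1_{\{h_{(\theta_0,\theta_1)}(T)<+\infty\}}$, with $(\theta_0,\theta_1)\in\Theta_0^f\times\Theta_1^f$. For $\theta\in\Theta$ let $m_\theta$ and $m'_\theta$ be the Borel probabilities on $\overline{\Delta_s}$ given by $m_\theta(\{g<e\})=E_\theta(e)$ for $e\in\overline{\Delta_s}$, $e\neq\inf\overline{\Delta_s}$, and $m'_\theta(\{g\le e\})=E_\theta(e)$ for $e\in\overline{\Delta_s}$, $e\ne\sup\overline{\Delta_s}$. The vote under $P_\theta$ is the probability on $\{0,1\}$ with $Q_\theta^\omega(\{1_f\})=\int_{\overline{\Delta_s}}g(\omega)\,d\frac{m_\theta+m'_\theta}{2}(g)$ and $Q_\theta^\omega(\{0_f\})=1-Q_\theta^\omega(\{1_f\})$. The most favourable votes under $\Theta_1^f$ and under $\Theta_0^f$ give, for all $\omega\in\Omega$ and $f\in\mathcal F$, $$Q_1^\omega(\Theta_1^f)=\sup_{\theta\in\Theta_1^f}Q_\theta^\omega(\{1_f\}),\qquad Q_0^\omega(\Theta_1^f)=1-\sup_{\theta\in\Theta_0^f}Q^\omega_\theta(\{0_f\}).$$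 *Essential statistics.* For a nondecreasing $X:\mathbb R\to\overline{\mathbb R}$, the mean distribution function of $X(T)$ under $P_\theta$ is $k\mapsto\frac12[P_\theta(X(T)<k)+P_\theta(X(T)\le k)]$. The essential statistic $K^f(T)$ of the problem $f$ is defined as follows. Put $e_t=\sup\{e\in\overline{\Delta_s}: e\le 1_{\{T<t\}}\}$ and $g_t=\inf\{e\in\overline{\Delta_s}:e\ge 1_{\{T\le t\}}\}$, and let $a_t,b_t\in\overline{\mathbb R}$ be the endpoints of the half-lines of $e_t$ and $g_t$ ($-\infty$ for $\emptyset$, $+\infty$ for $\mathbb R$). Then $K^f(t)=-\infty$ if the first set is empty; $K^f(t)=+\infty$ if the first is nonempty and the second is empty; when both are nonempty, $K^f(t)=b_t-1$ if $a_t=-\infty$, $K^f(t)=a_t+1$ if $a_t>-\infty$ and $b_t=+\infty$, and $K^f(t)=(a_t+b_t)/2$ if both are finite. Let $G^f_\theta$ be the mean distribution function of $K^f(T)$ under $P_\theta$. A global essential statistic is a statistic $K(T)$ with $K:\mathbb R\to\overline{\mathbb R}$ nondecreasing whose mean distribution functions $G_\theta$ satisfy, for all $f\in\mathcal F$: $G_\theta(K(t))=G_\theta^f(K^f(t))$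 for all $t\notin D_i^{\Theta_0^f}\cup D_s^{\Theta_1^f}\cup N$ and $\theta\in\Theta$; $G_\theta(K(t))=0$ for all $t\in D_i^{\Theta_0^f}\setminus N$ and $\theta\in\Theta_0^f$; $G_\theta(K(t))=1$ for all $t\in D_s^{\Theta_1^f}\setminus N$ and $\theta\in\Theta_1^f$. *Compatible votes.* A map $Q:(\omega,\Theta_1^f)\mapsto Q^\omega(\Theta_1^f)\in[0,1]$ defines compatible votes if for almost every $\omega$: (a) $\Theta_1^f\subset\Theta_1^{f'}$ implies $Q^\omega(\Theta_1^f)\le Q^\omega(\Theta_1^{f'})$; (b) if $\Theta_1^{f_n}$ increases to $\Theta$ (resp. decreases to $\emptyset$), then $Q^\omega(\Theta_1^{f_n})$ converges to $1$ (resp. $0$); (c) if $(\Theta_1^{f_n})_n$ is increasing, $(\Theta_1^{f'_n})_n$ is decreasing and the two sequences have the same limit, then $Q^\omega(\Theta_1^{f_n})$ and $Q^\omega(\Theta_1^{f'_n})$ converge to the same limit. **Proposition.** Let $K(T)$ be a global essential statistic, with mean distribution functions $G_\theta$ under $P_\theta$. Both maps $Q_1$ and $Q_0$ define compatible votes if and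 only if, for almost every $t\in\mathbb R$, the function $\theta\mapsto G_\theta(K(t))$ on $\Theta$ satisfies: 1. it is right-continuous at every $\theta_f\in\Theta\setminus\{\sup\Theta\}$ such that $t\notin D_i^{\{\theta>\theta_f\}}$; 2. it is left-continuous at every $\theta_f\in\Theta\setminus\{\inf\Theta\}$ such that $t\notin D_s^{\{\theta<\theta_f\}}$; 3. if $\inf\Theta\notin\Theta$, then $\lim_{\theta\to\inf\Theta}G_\theta(K(t))=1$; 4. if $\sup\Theta\notin\Theta$, then $\lim_{\theta\to\sup\Theta}G_\theta(K(t))=0$. If these conditions hold for almost every $t$, then for almost every $\omega$ there is a probability $\nu$ on the Borel sets of $\Theta$ which is both the unique probability with $\nu(\Theta_1^f)=Q_1^\omega(\Theta_1^f)$ for all $f\in\mathcal F$ and the unique probability with $\nu(\Theta_1^f)=Q_0^\omega(\Theta_1^f)$ for all $f\in\mathcal F$. -/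

import Mathlib

open MeasureTheory Set Filter Topology
open scoped ENNReal NNReal

noncomputable section

namespace ExpertVotes

/-! ### The totally ordered set of test functions based on the order of a real statistic

The indicators `f_(t,0) = 1_{T < t}`, `f_(t,1) = 1_{T ≤ t}`, `f_(-∞,1) = 0` and `f_(+∞,0) = 1` are
indexed, in the lexicographic order of the pairs `(t,u)`, by the lower half-lines
`]-∞,t[`, `]-∞,t]`, `∅`, `ℝ`, that is by the type `LowerSet ℝ` ordered by inclusion.  The test
function of the half-line `L` decides `1` at `ω` when `T ω ∈ L`, and `0` otherwise.
This ordered set carries its order topology and the Borel sets of that topology. -/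

instance instTopologicalSpaceCut : TopologicalSpace (LowerSet ℝ) := Preorder.topology (LowerSet ℝ)

instance instOrderTopologyCut : OrderTopology (LowerSet ℝ) := ⟨rfl⟩

instance instMeasurableSpaceCut : MeasurableSpace (LowerSet ℝ) := borel (LowerSet ℝ)

instance instBorelSpaceCut : BorelSpace (LowerSet ℝ) := ⟨rfl⟩

/-- The test function of the half-line `L`, evaluated at a point where the statistic is `t`. -/
def testValue (L : LowerSet ℝ) (t : ℝ) : ℝ := (L : Set ℝ).indicator (fun _ => 1) t

/-- The endpoint in `[-∞,+∞]` of a lower half-line (`-∞` for `∅`, `+∞` for `ℝ`). -/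
def endpoint (L : LowerSet ℝ) : EReal := ⨆ x ∈ L, (x : EReal)

/-- The largest element of `D` deciding `0` at `t`, and `inf D` if there is none. -/
def lowerExpert (D : Set (LowerSet ℝ)) (t : ℝ) : LowerSet ℝ :=
  open Classical in
  if {L | L ∈ D ∧ L ≤ LowerSet.Iio t}.Nonempty then sSup {L | L ∈ D ∧ L ≤ LowerSet.Iio t}
  else sInf D

/-- The smallest element of `D` deciding `1` at `t`, and `sup D` if there is none. -/
def upperExpert (D : Set (LowerSet ℝ)) (t : ℝ) : LowerSet ℝ :=
  open Classical in
  if {L | L ∈ D ∧ LowerSet.Iic t ≤ L}.Nonempty then sInf {L | L ∈ D ∧ LowerSet.Iic t ≤ L}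
  else sSup D

/-! ### Models with monotone likelihood ratio and unilateral hypotheses -/

variable {Ω : Type*} {Θ : Set ℝ}

/-- `(p_θ μ)_{θ ∈ Θ}` is a dominated statistical model: the `p_θ` are probability densities. -/
structure IsDominatedModel [MeasurableSpace Ω] (μ : Measure Ω) (p : Θ → Ω → ℝ≥0) : Prop where
  measurable : ∀ θ, Measurable (p θ)
  lintegral_eq_one : ∀ θ, ∫⁻ ω, (p θ ω : ℝ≥0∞) ∂μ = 1

/-- The probability `P_θ = p_θ μ`. -/
def law [MeasurableSpace Ω] (μ : Measure Ω) (p : Θ → Ω → ℝ≥0) (θ : Θ) : Measure Ω :=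
  μ.withDensity (fun ω => (p θ ω : ℝ≥0∞))

/-- `h` is nondecreasing with values in `[0,+∞]` and `q / r = h(T)` wherever this ratio is defined,
that is outside `{q = r = 0}` (with `q / 0 = +∞` for `q > 0`). -/
structure IsLikelihoodRatio (q r : Ω → ℝ≥0) (T : Ω → ℝ) (h : ℝ → ℝ≥0∞) : Prop where
  monotone : Monotone h
  ratio_eq : ∀ ω, ¬ (q ω = 0 ∧ r ω = 0) → (q ω : ℝ≥0∞) / (r ω : ℝ≥0∞) = h (T ω)

/-- Monotone likelihood ratio in the statistic `T`. -/
def IsMLR (p : Θ → Ω → ℝ≥0) (T : Ω → ℝ) : Prop :=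
  ∀ θ' θ'' : Θ, θ' < θ'' → ∃ h : ℝ → ℝ≥0∞, IsLikelihoodRatio (p θ'') (p θ') T h

/-- Unilateral hypotheses: an ordered partition `{Θ₁, Θ₀}` of `Θ` in two nonempty parts, every
element of `Θ₁` being below every element of `Θ₀`. -/
structure UnilateralHypotheses (Θ : Set ℝ) where
  /-- The lower hypothesis `Θ₁`. -/
  one : Set Θ
  /-- The upper hypothesis `Θ₀`. -/
  zero : Set Θ
  isCompl : IsCompl one zero
  one_nonempty : one.Nonempty
  zero_nonempty : zero.Nonempty
  lt : ∀ θ₁ ∈ one, ∀ θ₀ ∈ zero, θ₁ < θ₀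

/-- `D_i^A`: the largest lower half-line over which all the densities `p_θ`, `θ ∈ A`, vanish. -/
def lowerNull (p : Θ → Ω → ℝ≥0) (T : Ω → ℝ) (A : Set Θ) : Set ℝ :=
  {t | ∀ ω, T ω ≤ t → ∀ θ ∈ A, p θ ω = 0}

/-- `D_s^A`: the largest upper half-line over which all the densities `p_θ`, `θ ∈ A`, vanish. -/
def upperNull (p : Θ → Ω → ℝ≥0) (T : Ω → ℝ) (A : Set Θ) : Set ℝ :=
  {t | ∀ ω, t ≤ T ω → ∀ θ ∈ A, p θ ω = 0}

/-- `N`: the points over which all the densities of the model vanish. -/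
def nullPoints (p : Θ → Ω → ℝ≥0) (T : Ω → ℝ) : Set ℝ :=
  {t | ∀ ω, T ω = t → ∀ θ, p θ ω = 0}

/-- A normalised family `h_(θ₀,θ₁)`, `(θ₀,θ₁) ∈ Θ₀ × Θ₁`, for the hypotheses `f = {Θ₁, Θ₀}`. -/
structure IsNormalizedFamily (p : Θ → Ω → ℝ≥0) (T : Ω → ℝ) (f : UnilateralHypotheses Θ)
    (h : Θ → Θ → ℝ → ℝ≥0∞) : Prop where
  isLikelihoodRatio : ∀ θ₀ ∈ f.zero, ∀ θ₁ ∈ f.one, IsLikelihoodRatio (p θ₀) (p θ₁) T (h θ₀ θ₁)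
  const_of_null : ∀ θ₀ ∈ f.zero, ∀ θ₁ ∈ f.one, ∀ I : Set ℝ, I.OrdConnected →
    I ⊆ (lowerNull p T f.zero ∪ upperNull p T f.one)ᶜ →
    (∀ ω, T ω ∈ I → p θ₀ ω = 0 ∧ p θ₁ ω = 0) →
    ∀ s ∈ I, ∀ t ∈ I, h θ₀ θ₁ s = h θ₀ θ₁ t
  eq_top : ∀ θ₀ ∈ f.zero, ∀ θ₁ ∈ f.one, ∀ t ∈ upperNull p T f.one, h θ₀ θ₁ t = ∞
  eq_zero : ∀ θ₀ ∈ f.zero, ∀ θ₁ ∈ f.one,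
    ∀ t ∈ lowerNull p T f.zero \ upperNull p T f.one, h θ₀ θ₁ t = 0

/-- The simple test functions of one density ratio `h(T)`: the indicators of `{h(T) ≤ 0}`, of
`{h(T) < k}` and `{h(T) ≤ k}` for `0 < k < +∞`, and of `{h(T) < +∞}`. -/
def simpleTests (h : ℝ → ℝ≥0∞) : Set (LowerSet ℝ) :=
  {L | (L : Set ℝ) = {t | h t ≤ 0} ∨
    (∃ k : ℝ≥0∞, 0 < k ∧ k < ∞ ∧ ((L : Set ℝ) = {t | h t < k} ∨ (L : Set ℝ) = {t | h t ≤ k})) ∨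
    (L : Set ℝ) = {t | h t < ∞}}

/-- The voting experts for the hypotheses `f`: the closure of the set of all simple test functions
of the ratios `h_(θ₀,θ₁)(T)`, `(θ₀,θ₁) ∈ Θ₀ × Θ₁`. -/
def experts (f : UnilateralHypotheses Θ) (h : Θ → Θ → ℝ → ℝ≥0∞) : Set (LowerSet ℝ) :=
  closure {L | ∃ θ₀ ∈ f.zero, ∃ θ₁ ∈ f.one, L ∈ simpleTests (h θ₀ θ₁)}

/-! ### Votes of the experts -/

section Votes

variable [MeasurableSpace Ω]

/-- The probability `m` carried by the closed set of experts `D` with `m {g ∈ D | g < f} = E(f)`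
for `f ∈ D`, `f ≠ inf D`, where `E(f) = P(T ∈ f)` is the mean of the test function `f`.
(See `lowerVoteMeasure_Iio`, `ae_lowerVoteMeasure` and `isProbabilityMeasure_lowerVoteMeasure`.) -/
def lowerVoteMeasure (P : Measure Ω) (T : Ω → ℝ) (D : Set (LowerSet ℝ)) : Measure (LowerSet ℝ) :=
  P.map (fun ω => lowerExpert D (T ω))

/-- The probability `m'` carried by the closed set of experts `D` with `m' {g ∈ D | g ≤ f} = E(f)`
for `f ∈ D`, `f ≠ sup D`.
(See `upperVoteMeasure_Iic`, `ae_upperVoteMeasure` and `isProbabilityMeasure_upperVoteMeasure`.) -/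
def upperVoteMeasure (P : Measure Ω) (T : Ω → ℝ) (D : Set (LowerSet ℝ)) : Measure (LowerSet ℝ) :=
  P.map (fun ω => upperExpert D (T ω))

/-- `Q^ω({1})`: the frequency of the decision `1` at `ω` among the experts in `D`, weighted by the
probability `(m + m') / 2`, that is `∫ f(ω) d(m + m')/2`. -/
def voteOne (P : Measure Ω) (T : Ω → ℝ) (D : Set (LowerSet ℝ)) (ω : Ω) : ℝ :=
  ∫ L, testValue L (T ω)
    ∂((2 : ℝ≥0∞)⁻¹ • (lowerVoteMeasure P T D + upperVoteMeasure P T D))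

/-- `Q^ω({0}) = 1 - Q^ω({1})`. -/
def voteZero (P : Measure Ω) (T : Ω → ℝ) (D : Set (LowerSet ℝ)) (ω : Ω) : ℝ :=
  1 - voteOne P T D ω

/-- The most favourable vote under `Θ₁`, in favour of `Θ₁`:
`Q₁^ω(Θ₁) = Q_{Θ₁}^ω({1}) = sup_{θ ∈ Θ₁} Q_θ^ω({1})`. -/
def mostFavorableOne (μ : Measure Ω) (p : Θ → Ω → ℝ≥0) (T : Ω → ℝ)
    (h : UnilateralHypotheses Θ → Θ → Θ → ℝ → ℝ≥0∞) (ω : Ω) (f : UnilateralHypotheses Θ) : ℝ :=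
  ⨆ θ : f.one, voteOne (law μ p θ) T (experts f (h f)) ω

/-- The most favourable vote under `Θ₀`, in favour of `Θ₁`:
`Q₀^ω(Θ₁) = Q_{Θ₀}^ω({1}) = 1 - Q_{Θ₀}^ω({0})`, with
`Q_{Θ₀}^ω({0}) = sup_{θ ∈ Θ₀} Q_θ^ω({0})`. -/
def mostFavorableZero (μ : Measure Ω) (p : Θ → Ω → ℝ≥0) (T : Ω → ℝ)
    (h : UnilateralHypotheses Θ → Θ → Θ → ℝ → ℝ≥0∞) (ω : Ω) (f : UnilateralHypotheses Θ) : ℝ :=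
  1 - ⨆ θ : f.zero, voteZero (law μ p θ) T (experts f (h f)) ω

/-! ### Essential statistics -/

/-- The function `K` defining the essential statistic `K(T)` of a set of experts `D`. With
`f_(a,u) = sup {f ∈ D | f ≤ f_(t,0)}` and `f_(b,v) = inf {f ∈ D | f_(t,1) ≤ f}`, the value is
`-∞` (resp. `+∞`) if the first (resp. second) set is empty, and otherwise
`b - 1` if `a = -∞`, `a + 1` if `b = +∞` and `a > -∞`, and `(a + b) / 2` if both are finite. -/
def essentialMap (D : Set (LowerSet ℝ)) (t : ℝ) : EReal :=
  open Classical in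
  if ¬ {L | L ∈ D ∧ L ≤ LowerSet.Iio t}.Nonempty then ⊥
  else if ¬ {L | L ∈ D ∧ LowerSet.Iic t ≤ L}.Nonempty then ⊤
  else if endpoint (lowerExpert D t) = ⊥ then endpoint (upperExpert D t) - 1
  else if endpoint (upperExpert D t) = ⊤ then endpoint (lowerExpert D t) + 1
  else (endpoint (lowerExpert D t) + endpoint (upperExpert D t)) / 2

/-- The mean distribution function `[P(X < k) + P(X ≤ k)] / 2` of a statistic `X`. -/
def meanCDF (P : Measure Ω) (X : Ω → EReal) (k : EReal) : ℝ :=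
  (P.real {ω | X ω < k} + P.real {ω | X ω ≤ k}) / 2

/-- `G_θ(K(t))`, where `G_θ` is the mean distribution function of `K(T)` under `P_θ`. -/
def meanCDFAt (μ : Measure Ω) (p : Θ → Ω → ℝ≥0) (T : Ω → ℝ) (K : ℝ → EReal) (t : ℝ) (θ : Θ) : ℝ :=
  meanCDF (law μ p θ) (fun ω => K (T ω)) (K t)

/-- `K(T)` is a global essential statistic: `K` is nondecreasing and, for all unilateral hypotheses
`f = {Θ₁, Θ₀}` with essential statistic `K^f(T)`, of mean distribution functions `G_θ^f`,
1) `G_θ(K(t)) = G_θ^f(K^f(t))` for all `θ` and all `t` outside `D_i^{Θ₀} ∪ D_s^{Θ₁} ∪ N`,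
2) `G_θ(K(t)) = 0` for `t ∈ D_i^{Θ₀} - N`, `θ ∈ Θ₀`,
3) `G_θ(K(t)) = 1` for `t ∈ D_s^{Θ₁} - N`, `θ ∈ Θ₁`. -/
structure IsGlobalEssential (μ : Measure Ω) (p : Θ → Ω → ℝ≥0) (T : Ω → ℝ)
    (h : UnilateralHypotheses Θ → Θ → Θ → ℝ → ℝ≥0∞) (K : ℝ → EReal) : Prop where
  monotone : Monotone K
  eq_essential : ∀ f : UnilateralHypotheses Θ,
    ∀ t ∉ lowerNull p T f.zero ∪ upperNull p T f.one ∪ nullPoints p T, ∀ θ : Θ,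
      meanCDFAt μ p T K t θ = meanCDFAt μ p T (essentialMap (experts f (h f))) t θ
  eq_zero : ∀ f : UnilateralHypotheses Θ, ∀ t ∈ lowerNull p T f.zero \ nullPoints p T,
    ∀ θ ∈ f.zero, meanCDFAt μ p T K t θ = 0
  eq_one : ∀ f : UnilateralHypotheses Θ, ∀ t ∈ upperNull p T f.one \ nullPoints p T,
    ∀ θ ∈ f.one, meanCDFAt μ p T K t θ = 1

/-! ### Compatible votes -/

/-- "For almost every realisation": outside a set which is negligible for every `P_θ`. -/
def ModelAE (μ : Measure Ω) (p : Θ → Ω → ℝ≥0) (A : Ω → Prop) : Prop :=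
  ∀ θ : Θ, ∀ᵐ ω ∂(law μ p θ), A ω

/-- The three compatibility properties of a family `f ↦ Q(Θ₁^f)`, at one realisation. -/
structure IsCompatibleAt (Q : UnilateralHypotheses Θ → ℝ) : Prop where
  mono : ∀ f f' : UnilateralHypotheses Θ, f.one ⊂ f'.one → Q f ≤ Q f'
  tendsto_one : ∀ f : ℕ → UnilateralHypotheses Θ, Monotone (fun n => (f n).one) →
    (⋃ n, (f n).one) = univ → Tendsto (fun n => Q (f n)) atTop (𝓝 1)
  tendsto_zero : ∀ f : ℕ → UnilateralHypotheses Θ, Antitone (fun n => (f n).one) →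
    (⋂ n, (f n).one) = ∅ → Tendsto (fun n => Q (f n)) atTop (𝓝 0)
  same_limit : ∀ f f' : ℕ → UnilateralHypotheses Θ, Monotone (fun n => (f n).one) →
    Antitone (fun n => (f' n).one) → (⋃ n, (f n).one) = ⋂ n, (f' n).one →
    ∃ l : ℝ, Tendsto (fun n => Q (f n)) atTop (𝓝 l) ∧ Tendsto (fun n => Q (f' n)) atTop (𝓝 l)

/-- `Q` defines compatible votes. -/
def AreCompatibleVotes (μ : Measure Ω) (p : Θ → Ω → ℝ≥0) (Q : Ω → UnilateralHypotheses Θ → ℝ) :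
    Prop :=
  ModelAE μ p (fun ω => IsCompatibleAt (Q ω))

/-- `ν` is a probability on the Borel sets of `Θ` extending `Θ₁^f ↦ Q(Θ₁^f)`. -/
structure IsProbabilityExtension (Q : UnilateralHypotheses Θ → ℝ) (ν : Measure Θ) : Prop where
  isProbabilityMeasure : IsProbabilityMeasure ν
  real_one : ∀ f : UnilateralHypotheses Θ, ν.real f.one = Q f

/-- The four conditions on `θ ↦ G_θ(K(t))` at the point `t`. -/
structure RegularAt (μ : Measure Ω) (p : Θ → Ω → ℝ≥0) (T : Ω → ℝ) (K : ℝ → EReal) (t : ℝ) :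
    Prop where
  right_continuous : ∀ θf : Θ, ¬ IsGreatest Θ θf → t ∉ lowerNull p T {θ | θf < θ} →
    ContinuousWithinAt (meanCDFAt μ p T K t) (Ici θf) θf
  left_continuous : ∀ θf : Θ, ¬ IsLeast Θ θf → t ∉ upperNull p T {θ | θ < θf} →
    ContinuousWithinAt (meanCDFAt μ p T K t) (Iic θf) θf
  tendsto_inf : (¬ ∃ a, IsLeast Θ a) → Tendsto (meanCDFAt μ p T K t) atBot (𝓝 1)
  tendsto_sup : (¬ ∃ b, IsGreatest Θ b) → Tendsto (meanCDFAt μ p T K t) atTop (𝓝 0)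

end Votes

/-! ### The vote measures have the defining properties -/

theorem isClosed_sSup_mem {D : Set (LowerSet ℝ)} (hD : IsClosed D) {A : Set (LowerSet ℝ)}
    (hA : A.Nonempty) (hAD : A ⊆ D) : sSup A ∈ D :=
  hD.closure_subset_iff.2 hAD (sSup_mem_closure hA)

theorem isClosed_sInf_mem {D : Set (LowerSet ℝ)} (hD : IsClosed D) {A : Set (LowerSet ℝ)}
    (hA : A.Nonempty) (hAD : A ⊆ D) : sInf A ∈ D :=
  hD.closure_subset_iff.2 hAD (sInf_mem_closure hA)

theorem Iic_le_or_le_Iio (t : ℝ) (L : LowerSet ℝ) :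
    (t ∈ L ∧ LowerSet.Iic t ≤ L) ∨ (t ∉ L ∧ L ≤ LowerSet.Iio t) := by
  by_cases h : t ∈ L
  · exact Or.inl ⟨h, fun x hx => L.lower hx h⟩
  · refine Or.inr ⟨h, fun x hx => ?_⟩
    by_contra hc
    exact h (L.lower (not_lt.1 hc) hx)

theorem le_Iio_iff {t : ℝ} {L : LowerSet ℝ} : L ≤ LowerSet.Iio t ↔ t ∉ L :=
  ⟨fun h ht => lt_irrefl t (h ht), fun h => ((Iic_le_or_le_Iio t L).resolve_left (fun h' => h h'.1)).2⟩

theorem Iic_le_iff {t : ℝ} {L : LowerSet ℝ} : LowerSet.Iic t ≤ L ↔ t ∈ L :=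
  ⟨fun h => h (le_refl t), fun h => ((Iic_le_or_le_Iio t L).resolve_right (fun h' => h'.1 h)).2⟩

theorem lowerExpert_mem {D : Set (LowerSet ℝ)} (hD : IsClosed D) (hne : D.Nonempty) (t : ℝ) :
    lowerExpert D t ∈ D := by
  unfold lowerExpert
  split_ifs with h
  · exact isClosed_sSup_mem hD h (fun L hL => hL.1)
  · exact isClosed_sInf_mem hD hne subset_rfl

theorem upperExpert_mem {D : Set (LowerSet ℝ)} (hD : IsClosed D) (hne : D.Nonempty) (t : ℝ) :
    upperExpert D t ∈ D := by
  unfold upperExpert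
  split_ifs with h
  · exact isClosed_sInf_mem hD h (fun L hL => hL.1)
  · exact isClosed_sSup_mem hD hne subset_rfl

theorem lowerExpert_lt_iff {D : Set (LowerSet ℝ)} {f : LowerSet ℝ} (hf : f ∈ D)
    (hmin : f ≠ sInf D) (t : ℝ) : lowerExpert D t < f ↔ t ∈ f := by
  constructor
  · intro hlt
    by_contra ht
    have hmem : f ∈ {L | L ∈ D ∧ L ≤ LowerSet.Iio t} := ⟨hf, le_Iio_iff.2 ht⟩
    have hle : f ≤ lowerExpert D t := by
      unfold lowerExpert
      rw [if_pos ⟨f, hmem⟩]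
      exact le_sSup hmem
    exact absurd hlt (not_lt.2 hle)
  · intro ht
    unfold lowerExpert
    split_ifs with h
    · have h1 : sSup {L | L ∈ D ∧ L ≤ LowerSet.Iio t} ≤ LowerSet.Iio t := sSup_le (fun L hL => hL.2)
      exact lt_of_le_not_ge (h1.trans (fun x hx => f.lower (le_of_lt hx) ht))
        (fun h2 => lt_irrefl t (h1 (h2 ht)))
    · exact lt_of_le_of_ne (sInf_le hf) hmin.symm

theorem upperExpert_le_iff {D : Set (LowerSet ℝ)} {f : LowerSet ℝ} (hf : f ∈ D)
    (hmax : f ≠ sSup D) (t : ℝ) : upperExpert D t ≤ f ↔ t ∈ f := by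
  constructor
  · intro hle
    unfold upperExpert at hle
    split_ifs at hle with h
    · have h1 : LowerSet.Iic t ≤ sInf {L | L ∈ D ∧ LowerSet.Iic t ≤ L} := le_sInf (fun L hL => hL.2)
      exact Iic_le_iff.1 (h1.trans hle)
    · exact absurd (le_antisymm (le_sSup hf) hle) hmax
  · intro ht
    have hmem : f ∈ {L | L ∈ D ∧ LowerSet.Iic t ≤ L} := ⟨hf, Iic_le_iff.2 ht⟩
    unfold upperExpert
    rw [if_pos ⟨f, hmem⟩]
    exact sInf_le hmem

theorem lowerExpert_mono (D : Set (LowerSet ℝ)) : Monotone (lowerExpert D) := by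
  intro s t hst
  have hsub : LowerSet.Iio s ≤ LowerSet.Iio t := fun x (hx : x < s) => lt_of_lt_of_le hx hst
  unfold lowerExpert
  split_ifs with h1 h2 h2
  · exact sSup_le_sSup (fun L hL => ⟨hL.1, hL.2.trans hsub⟩)
  · exact absurd (h1.mono (t := {L | L ∈ D ∧ L ≤ LowerSet.Iio t})
      (fun L hL => ⟨hL.1, hL.2.trans hsub⟩)) h2
  · obtain ⟨L, hL⟩ := h2
    exact (sInf_le hL.1).trans (le_sSup hL)
  · exact le_rfl

theorem upperExpert_mono (D : Set (LowerSet ℝ)) : Monotone (upperExpert D) := by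
  intro s t hst
  have hsub : LowerSet.Iic s ≤ LowerSet.Iic t := fun x (hx : x ≤ s) => le_trans hx hst
  unfold upperExpert
  split_ifs with h1 h2 h2
  · exact sInf_le_sInf (fun L hL => ⟨hL.1, hsub.trans hL.2⟩)
  · obtain ⟨L, hL⟩ := h1
    exact (sInf_le hL).trans (le_sSup hL.1)
  · exact absurd (h2.mono (t := {L | L ∈ D ∧ LowerSet.Iic s ≤ L})
      (fun L hL => ⟨hL.1, hsub.trans hL.2⟩)) h1
  · exact le_rfl

/-- The half-lines with infinite or rational endpoint. -/
def ratCuts : Set (LowerSet ℝ) :=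
  {⊥, ⊤} ∪ (range (fun q : ℚ => LowerSet.Iio (q : ℝ)) ∪ range (fun q : ℚ => LowerSet.Iic (q : ℝ)))

theorem countable_ratCuts : ratCuts.Countable :=
  ((countable_singleton _).insert _).union ((countable_range _).union (countable_range _))

theorem eq_bot_or_top_or_Iio_or_Iic (L : LowerSet ℝ) :
    L = ⊥ ∨ L = ⊤ ∨ ∃ x : ℝ, L = LowerSet.Iio x ∨ L = LowerSet.Iic x := by
  by_cases h0 : (L : Set ℝ).Nonempty
  · by_cases h1 : BddAbove (L : Set ℝ)
    · refine Or.inr (Or.inr ⟨sSup (L : Set ℝ), ?_⟩)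
      by_cases hs : sSup (L : Set ℝ) ∈ L
      · exact Or.inr (le_antisymm (fun x hx => le_csSup h1 hx) (Iic_le_iff.2 hs))
      · refine Or.inl (le_antisymm (le_Iio_iff.2 hs) (fun x hx => ?_))
        obtain ⟨y, hy, hxy⟩ := exists_lt_of_lt_csSup h0 hx
        exact L.lower hxy.le hy
    · refine Or.inr (Or.inl (eq_top_iff.2 (fun x _ => ?_)))
      obtain ⟨y, hy, hxy⟩ := not_bddAbove_iff.1 h1 x
      exact L.lower hxy.le hy
  · refine Or.inl (eq_bot_iff.2 (fun x hx => ?_))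
    exact absurd ⟨x, hx⟩ h0

/-- Outside a countable set, a point of an open set `U` lies in an interval with endpoints in
`ratCuts` which is contained in `U`. -/
theorem countable_diff_of_isOpen {U : Set (LowerSet ℝ)} (hU : IsOpen U) :
    {L ∈ U | ¬ ∃ c ∈ ratCuts, ∃ d ∈ ratCuts, L ∈ Icc c d ∧ Icc c d ⊆ U}.Countable := by
  set B := {L ∈ U | ¬ ∃ c ∈ ratCuts, ∃ d ∈ ratCuts, L ∈ Icc c d ∧ Icc c d ⊆ U} with hB
  have key1 : ∀ x : ℝ, LowerSet.Iio x ∈ B →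
      ∃ q : ℚ, (q : ℝ) < x ∧ Icc (LowerSet.Iic (q : ℝ)) (LowerSet.Iio x) ⊆ U := by
    intro x hx
    obtain ⟨l, hl, hlU⟩ := exists_Ioc_subset_of_mem_nhds (hU.mem_nhds hx.1)
      ⟨⊥, bot_lt_iff_ne_bot.2 (fun h0 => by
        have : x - 1 ∈ (⊥ : LowerSet ℝ) := h0 ▸ (show x - 1 ∈ LowerSet.Iio x by simp)
        simp at this)⟩
    obtain ⟨y, hyx, hyl⟩ := Set.not_subset.1 (not_le_of_gt hl)
    obtain ⟨q, hyq, hqx⟩ := exists_rat_btwn (show y < x from hyx)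
    refine ⟨q, hqx, fun M hM => hlU ⟨lt_of_lt_of_le ?_ hM.1, hM.2⟩⟩
    have h1 : l ≤ LowerSet.Iio y := le_Iio_iff.2 hyl
    exact lt_of_le_of_lt h1 (lt_of_le_not_ge (fun z hz => le_of_lt (lt_trans hz hyq))
      (fun h2 => lt_irrefl y (h2 (show y ≤ (q : ℝ) from hyq.le))))
  have key2 : ∀ x : ℝ, LowerSet.Iic x ∈ B →
      ∃ q : ℚ, x < (q : ℝ) ∧ Icc (LowerSet.Iic x) (LowerSet.Iio (q : ℝ)) ⊆ U := by
    intro x hx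
    obtain ⟨u, hu, huU⟩ := exists_Ico_subset_of_mem_nhds (hU.mem_nhds hx.1)
      ⟨⊤, lt_top_iff_ne_top.2 (fun h0 => by
        have : x + 1 ∈ LowerSet.Iic x := h0 ▸ (show x + 1 ∈ (⊤ : LowerSet ℝ) by simp)
        simp at this; linarith)⟩
    obtain ⟨y, hyu, hyx⟩ := Set.not_subset.1 (not_le_of_gt hu)
    have hxy : x < y := not_le.1 hyx
    obtain ⟨q, hxq, hqy⟩ := exists_rat_btwn hxy
    refine ⟨q, hxq, fun M hM => huU ⟨hM.1, lt_of_le_of_lt hM.2 ?_⟩⟩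
    have h1 : LowerSet.Iic y ≤ u := Iic_le_iff.2 hyu
    exact lt_of_lt_of_le (lt_of_le_not_ge (fun z (hz : z < q) => le_of_lt (lt_trans hz hqy))
      (fun h2 => lt_asymm hqy (h2 (le_refl y)))) h1
  have hA1 : {x : ℝ | LowerSet.Iio x ∈ B}.Countable := by
    choose! q hq hqU using key1
    refine MapsTo.countable_of_injOn (t := univ) (f := q) (fun _ _ => mem_univ _) ?_
      (to_countable _)
    have aux : ∀ x y : ℝ, LowerSet.Iio x ∈ B → LowerSet.Iio y ∈ B → q x = q y → ¬ x < y := by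
      intro x y hx hy hxy hlt
      obtain ⟨r, hxr, hry⟩ := exists_rat_btwn hlt
      refine hx.2 ⟨LowerSet.Iic (q x : ℝ), Or.inr (Or.inr ⟨_, rfl⟩), LowerSet.Iio (r : ℝ),
        Or.inr (Or.inl ⟨_, rfl⟩), ⟨fun z (hz : z ≤ _) => lt_of_le_of_lt hz (hq x hx),
        fun z (hz : z < _) => lt_trans hz hxr⟩, fun M hM => hqU y hy ⟨hxy ▸ hM.1,
        hM.2.trans (fun z (hz : z < _) => lt_trans hz hry)⟩⟩
    intro x hx y hy hxy
    exact le_antisymm (not_lt.1 (aux y x hy hx hxy.symm)) (not_lt.1 (aux x y hx hy hxy))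
  have hA2 : {x : ℝ | LowerSet.Iic x ∈ B}.Countable := by
    choose! q hq hqU using key2
    refine MapsTo.countable_of_injOn (t := univ) (f := q) (fun _ _ => mem_univ _) ?_
      (to_countable _)
    have aux : ∀ x y : ℝ, LowerSet.Iic x ∈ B → LowerSet.Iic y ∈ B → q x = q y → ¬ x < y := by
      intro x y hx hy hxy hlt
      obtain ⟨r, hxr, hry⟩ := exists_rat_btwn hlt
      refine hy.2 ⟨LowerSet.Iic (r : ℝ), Or.inr (Or.inr ⟨_, rfl⟩), LowerSet.Iio (q y : ℝ),
        Or.inr (Or.inl ⟨_, rfl⟩), ⟨fun z (hz : z ≤ _) => le_trans hz hry.le,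
        fun z (hz : z ≤ _) => lt_of_le_of_lt hz (hq y hy)⟩, fun M hM => hqU x hx ⟨?_,
        hxy ▸ hM.2⟩⟩
      exact le_trans (fun z (hz : z ≤ _) => le_trans hz hxr.le) hM.1
    intro x hx y hy hxy
    exact le_antisymm (not_lt.1 (aux y x hy hx hxy.symm)) (not_lt.1 (aux x y hx hy hxy))
  refine ((((countable_singleton (⊤ : LowerSet ℝ)).insert ⊥).union
    (hA1.image LowerSet.Iio)).union (hA2.image LowerSet.Iic)).mono (fun L hL => ?_)
  rcases eq_bot_or_top_or_Iio_or_Iic L with h | h | ⟨x, h | h⟩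
  · exact Or.inl (Or.inl (Or.inl h))
  · exact Or.inl (Or.inl (Or.inr h))
  · exact Or.inl (Or.inr ⟨x, (h ▸ hL : LowerSet.Iio x ∈ B), h.symm⟩)
  · exact Or.inr ⟨x, (h ▸ hL : LowerSet.Iic x ∈ B), h.symm⟩

theorem measurable_of_monotone {φ : ℝ → LowerSet ℝ} (hφ : Monotone φ) : Measurable φ := by
  refine measurable_of_isOpen (fun U hU => ?_)
  have hI : ∀ c d : LowerSet ℝ, MeasurableSet (φ ⁻¹' Icc c d) := fun c d =>
    (ordConnected_Icc.preimage_mono hφ).measurableSet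
  have hS : ∀ L : LowerSet ℝ, MeasurableSet (φ ⁻¹' {L}) := fun L => by
    rw [← Icc_self]; exact hI L L
  have hEq : φ ⁻¹' U =
      (⋃ c ∈ ratCuts, ⋃ d ∈ ratCuts, ⋃ _ : Icc c d ⊆ U, φ ⁻¹' Icc c d) ∪
      ⋃ L ∈ {L ∈ U | ¬ ∃ c ∈ ratCuts, ∃ d ∈ ratCuts, L ∈ Icc c d ∧ Icc c d ⊆ U}, φ ⁻¹' {L} := by
    ext t
    constructor
    · intro ht
      by_cases h : ∃ c ∈ ratCuts, ∃ d ∈ ratCuts, φ t ∈ Icc c d ∧ Icc c d ⊆ U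
      · obtain ⟨c, hc, d, hd, h1, h2⟩ := h
        left
        simp only [mem_iUnion]
        exact ⟨c, hc, d, hd, h2, h1⟩
      · right
        simp only [mem_iUnion]
        exact ⟨φ t, ⟨ht, h⟩, rfl⟩
    · rintro (ht | ht)
      · simp only [mem_iUnion] at ht
        obtain ⟨c, hc, d, hd, h2, h1⟩ := ht
        exact h2 h1
      · simp only [mem_iUnion] at ht
        obtain ⟨L, hL, h1⟩ := ht
        have h2 : φ t = L := h1
        exact (h2 ▸ hL.1 : φ t ∈ U)
  rw [hEq]
  refine MeasurableSet.union ?_ (MeasurableSet.biUnion (countable_diff_of_isOpen hU) fun L _ => hS L)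
  exact MeasurableSet.biUnion countable_ratCuts fun c _ =>
    MeasurableSet.biUnion countable_ratCuts fun d _ => MeasurableSet.iUnion fun _ => hI c d

section VoteMeasures

variable [MeasurableSpace Ω] {P : Measure Ω} {T : Ω → ℝ} {D : Set (LowerSet ℝ)}

theorem measurable_lowerExpert_comp (hT : Measurable T) (D : Set (LowerSet ℝ)) :
    Measurable (fun ω => lowerExpert D (T ω)) :=
  (measurable_of_monotone (lowerExpert_mono D)).comp hT

theorem measurable_upperExpert_comp (hT : Measurable T) (D : Set (LowerSet ℝ)) :
    Measurable (fun ω => upperExpert D (T ω)) :=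
  (measurable_of_monotone (upperExpert_mono D)).comp hT

theorem isProbabilityMeasure_lowerVoteMeasure [IsProbabilityMeasure P] (hT : Measurable T) :
    IsProbabilityMeasure (lowerVoteMeasure P T D) :=
  Measure.isProbabilityMeasure_map (measurable_lowerExpert_comp hT D).aemeasurable

theorem isProbabilityMeasure_upperVoteMeasure [IsProbabilityMeasure P] (hT : Measurable T) :
    IsProbabilityMeasure (upperVoteMeasure P T D) :=
  Measure.isProbabilityMeasure_map (measurable_upperExpert_comp hT D).aemeasurable

theorem ae_lowerVoteMeasure (hT : Measurable T) (hD : IsClosed D) (hne : D.Nonempty) :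
    ∀ᵐ L ∂(lowerVoteMeasure P T D), L ∈ D :=
  (ae_map_iff (measurable_lowerExpert_comp hT D).aemeasurable hD.measurableSet).2
    (Eventually.of_forall fun ω => lowerExpert_mem hD hne (T ω))

theorem ae_upperVoteMeasure (hT : Measurable T) (hD : IsClosed D) (hne : D.Nonempty) :
    ∀ᵐ L ∂(upperVoteMeasure P T D), L ∈ D :=
  (ae_map_iff (measurable_upperExpert_comp hT D).aemeasurable hD.measurableSet).2
    (Eventually.of_forall fun ω => upperExpert_mem hD hne (T ω))

theorem lowerVoteMeasure_Iio (hT : Measurable T) {f : LowerSet ℝ} (hf : f ∈ D)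
    (hmin : f ≠ sInf D) : lowerVoteMeasure P T D (Iio f) = P {ω | T ω ∈ f} := by
  unfold lowerVoteMeasure
  rw [Measure.map_apply (measurable_lowerExpert_comp hT D) isOpen_Iio.measurableSet]
  congr 1
  ext ω
  exact lowerExpert_lt_iff hf hmin (T ω)

theorem upperVoteMeasure_Iic (hT : Measurable T) {f : LowerSet ℝ} (hf : f ∈ D)
    (hmax : f ≠ sSup D) : upperVoteMeasure P T D (Iic f) = P {ω | T ω ∈ f} := by
  unfold upperVoteMeasure
  rw [Measure.map_apply (measurable_upperExpert_comp hT D) isClosed_Iic.measurableSet]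
  congr 1
  ext ω
  exact upperExpert_le_iff hf hmax (T ω)

end VoteMeasures

end ExpertVotes

end

open MeasureTheory Set Filter Topology
open scoped ENNReal NNReal

namespace ExpertVotes

/-! Fix a realisation with `T ω = t`. The essential map is strictly increasing between two points
exactly when some expert decides `1` at the first and `0` at the second (`essentialMap_lt_iff`).
Hence the vote under `P_θ` in favour of `Θ₁` is `1 - G_θ^f(K^f(t))`, which the global statistic
turns into `1 - g θ` with `g θ = G_θ(K(t))`. The exceptions are the zones `D_i` and `D_s`, where all
experts agree and the vote is `1` or `0`. A monotone likelihood ratio makes `g` antitone. These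
facts, bundled in `IsVoteProfile`, hold for almost every realisation, and the rest is an argument
about one antitone function on an interval.

Every ordered partition cuts `Θ` at a point `a`, with `a` on either side. Outside the zones, `Q₁` is
the supremum of `1 - g` over `Θ₁` and `Q₀` its infimum over `Θ₀`. So `Q₁` is exactly `1 - g a` on
`{θ ≤ a}`, and `Q₀` is exactly `1 - g a` on `{θ < a}`. Compatibility of `Q₁` along cuts `{θ ≤ b}`
gives right-continuity and the limit at `inf Θ`; compatibility of `Q₀` along cuts `{θ < b}` gives
left-continuity and the limit at `sup Θ`.

Conversely, continuity closes the gap between supremum and infimum, so `Q₁ = Q₀`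
(`infVoteOne_eq_supVoteOne`). It also provides a quantile for every level in `(0,1)`
(`exists_quantile`). Pushing Lebesgue measure forward by the quantile function gives a probability
extending the common vote, from which compatibility follows; uniqueness holds because half-lines
determine a probability. -/

/-! ### The order that the essential map induces on the real line. -/

theorem coe_le_endpoint {L : LowerSet ℝ} {x : ℝ} (hx : x ∈ L) : (x : EReal) ≤ endpoint L :=
  le_iSup₂ (f := fun (x : ℝ) (_ : x ∈ L) => (x : EReal)) x hx

theorem endpoint_le_coe {L : LowerSet ℝ} {x : ℝ} (hx : x ∉ L) : endpoint L ≤ x :=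
  iSup₂_le fun y hy => EReal.coe_le_coe_iff.2 <| by
    by_contra hc
    exact hx (L.lower (not_le.1 hc).le hy)

theorem endpoint_mono : Monotone endpoint := fun _ _ hLM =>
  iSup₂_le fun _ hy => coe_le_endpoint (hLM hy)

theorem notMem_lowerExpert {D : Set (LowerSet ℝ)} {t : ℝ}
    (h : {L | L ∈ D ∧ L ≤ LowerSet.Iio t}.Nonempty) : t ∉ lowerExpert D t := by
  unfold lowerExpert
  rw [if_pos h, ← le_Iio_iff]
  exact sSup_le fun L hL => hL.2

theorem mem_upperExpert {D : Set (LowerSet ℝ)} {t : ℝ}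
    (h : {L | L ∈ D ∧ LowerSet.Iic t ≤ L}.Nonempty) : t ∈ upperExpert D t := by
  unfold upperExpert
  rw [if_pos h, ← Iic_le_iff]
  exact le_sInf fun L hL => hL.2

theorem le_lowerExpert {D : Set (LowerSet ℝ)} {t : ℝ} {e : LowerSet ℝ} (he : e ∈ D)
    (ht : t ∉ e) : e ≤ lowerExpert D t := by
  have hm : e ∈ {L | L ∈ D ∧ L ≤ LowerSet.Iio t} := ⟨he, le_Iio_iff.2 ht⟩
  unfold lowerExpert
  rw [if_pos ⟨e, hm⟩]
  exact le_sSup hm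

theorem upperExpert_le {D : Set (LowerSet ℝ)} {t : ℝ} {e : LowerSet ℝ} (he : e ∈ D)
    (ht : t ∈ e) : upperExpert D t ≤ e := by
  have hm : e ∈ {L | L ∈ D ∧ LowerSet.Iic t ≤ L} := ⟨he, Iic_le_iff.2 ht⟩
  unfold upperExpert
  rw [if_pos ⟨e, hm⟩]
  exact sInf_le hm

/-- The value is `-∞`, `b - 1`, or a midpoint `(a + b) / 2` with `a ≤ t ≤ b`; the midpoint can reach
`b` only if `t = b`. This exceptional case is kept apart because strictness must then come from the
order of the two separated points. -/
theorem essentialMap_le_of_mem {D : Set (LowerSet ℝ)} {t b : ℝ} {e : LowerSet ℝ} (he : e ∈ D)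
    (ht : t ∈ e) (hb : endpoint (upperExpert D t) = b) :
    essentialMap D t < b ∨ b = t ∧ essentialMap D t ≤ b := by
  have hne : {L | L ∈ D ∧ LowerSet.Iic t ≤ L}.Nonempty := ⟨e, he, Iic_le_iff.2 ht⟩
  have htb : t ≤ b := by
    rw [← EReal.coe_le_coe_iff, ← hb]; exact coe_le_endpoint (mem_upperExpert hne)
  unfold essentialMap
  rw [hb, if_neg (not_not.2 hne)]
  split_ifs with h1 h2 h3
  · left
    rw [← EReal.coe_one, ← EReal.coe_sub, EReal.coe_lt_coe_iff]; linarith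
  · exact absurd h3 (EReal.coe_ne_top b)
  · have hat := endpoint_le_coe (notMem_lowerExpert h1)
    generalize endpoint (lowerExpert D t) = a at *
    induction a with
    | bot => exact absurd rfl h2
    | top => simp at hat
    | coe a =>
      have hat' := EReal.coe_le_coe_iff.1 hat
      have h4 : ((a : EReal) + b) / 2 = ((a + b) / 2 : ℝ) := rfl
      rw [h4, EReal.coe_lt_coe_iff, EReal.coe_le_coe_iff]
      rcases htb.eq_or_lt with h | h
      · exact Or.inr ⟨h.symm, by linarith⟩
      · left; linarith
  · exact Or.inl (EReal.bot_lt_coe b)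

theorem le_essentialMap_of_notMem {D : Set (LowerSet ℝ)} {t a : ℝ} {e : LowerSet ℝ} (he : e ∈ D)
    (ht : t ∉ e) (ha : endpoint (lowerExpert D t) = a) :
    a < essentialMap D t ∨ a = t ∧ a ≤ essentialMap D t := by
  have hne : {L | L ∈ D ∧ L ≤ LowerSet.Iio t}.Nonempty := ⟨e, he, le_Iio_iff.2 ht⟩
  have hat : a ≤ t := by
    rw [← EReal.coe_le_coe_iff, ← ha]; exact endpoint_le_coe (notMem_lowerExpert hne)
  unfold essentialMap
  rw [ha, if_neg (not_not.2 hne)]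
  split_ifs with h1 h2 h3
  · exact absurd h2 (EReal.coe_ne_bot a)
  · left
    rw [← EReal.coe_one, ← EReal.coe_add, EReal.coe_lt_coe_iff]; linarith
  · have htb := coe_le_endpoint (mem_upperExpert h1)
    generalize endpoint (upperExpert D t) = b at *
    induction b with
    | top => exact absurd rfl h3
    | bot => simp at htb
    | coe b =>
      have htb' := EReal.coe_le_coe_iff.1 htb
      have h4 : ((a : EReal) + b) / 2 = ((a + b) / 2 : ℝ) := rfl
      rw [h4, EReal.coe_lt_coe_iff, EReal.coe_le_coe_iff]
      rcases hat.eq_or_lt with h | h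
      · exact Or.inr ⟨h, by linarith⟩
      · left; linarith
  · exact Or.inl (EReal.coe_lt_top a)

/-- Two points separated by an expert have distinct essential values. -/
theorem essentialMap_lt_of_separated {D : Set (LowerSet ℝ)} {s t : ℝ} {e : LowerSet ℝ}
    (he : e ∈ D) (ht : t ∈ e) (hs : s ∉ e) : essentialMap D t < essentialMap D s := by
  have hts : t < s := by
    by_contra hc
    exact hs (e.lower (not_lt.1 hc) ht)
  have hb1 : endpoint (upperExpert D t) ≤ endpoint e := endpoint_mono (upperExpert_le he ht)
  have ha1 : endpoint e ≤ endpoint (lowerExpert D s) := endpoint_mono (le_lowerExpert he hs)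
  have hb2 : (t : EReal) ≤ endpoint (upperExpert D t) :=
    coe_le_endpoint (mem_upperExpert ⟨e, he, Iic_le_iff.2 ht⟩)
  have ha2 : endpoint (lowerExpert D s) ≤ s :=
    endpoint_le_coe (notMem_lowerExpert ⟨e, he, le_Iio_iff.2 hs⟩)
  have hba := hb1.trans ha1
  -- Both endpoints around the separating expert lie between `t` and `s`, so they are finite and the
  -- two one-sided bounds apply.
  have real_of : ∀ x : EReal, (t : EReal) ≤ x → x ≤ s → ∃ y : ℝ, x = y := fun x h1 h2 =>
    ⟨x.toReal, (EReal.coe_toReal (ne_top_of_le_ne_top (EReal.coe_ne_top s) h2)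
      (ne_bot_of_le_ne_bot (EReal.coe_ne_bot t) h1)).symm⟩
  obtain ⟨b, hb⟩ := real_of _ hb2 (hba.trans ha2)
  obtain ⟨a, ha⟩ := real_of _ (hb2.trans hba) ha2
  have hba' : (b : EReal) ≤ a := hb ▸ ha ▸ hba
  rcases essentialMap_le_of_mem he ht hb with h1 | ⟨h1, h1'⟩
  · rcases le_essentialMap_of_notMem he hs ha with h2 | ⟨-, h2⟩
    · exact (h1.trans_le hba').trans h2
    · exact (h1.trans_le hba').trans_le h2
  · rcases le_essentialMap_of_notMem he hs ha with h2 | ⟨h2, h2'⟩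
    · exact (h1'.trans hba').trans_lt h2
    -- Neither bound is strict here, but then the endpoints are `t` and `s` themselves, and `t < s`.
    · refine (h1'.trans_lt ?_).trans_le h2'
      rw [h1, h2]
      exact EReal.coe_lt_coe_iff.2 hts

theorem essentialMap_congr {D : Set (LowerSet ℝ)} {s t : ℝ}
    (h : ∀ e ∈ D, t ∈ e ↔ s ∈ e) : essentialMap D t = essentialMap D s := by
  have h1 : {L | L ∈ D ∧ L ≤ LowerSet.Iio t} = {L | L ∈ D ∧ L ≤ LowerSet.Iio s} := by
    ext L
    simp only [mem_ofPred_eq, le_Iio_iff]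
    exact and_congr_right fun hL => not_congr (h L hL)
  have h2 : {L | L ∈ D ∧ LowerSet.Iic t ≤ L} = {L | L ∈ D ∧ LowerSet.Iic s ≤ L} := by
    ext L
    simp only [mem_ofPred_eq, Iic_le_iff]
    exact and_congr_right fun hL => h L hL
  unfold essentialMap lowerExpert upperExpert
  rw [h1, h2]

/-- If no expert separates the points in this direction, either one separates them the other way,
which reverses the inequality, or all experts agree on them, which makes the values equal. -/
theorem essentialMap_lt_iff {D : Set (LowerSet ℝ)} {s t : ℝ} :
    essentialMap D t < essentialMap D s ↔ ∃ e ∈ D, t ∈ e ∧ s ∉ e := by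
  refine ⟨fun hlt => ?_, fun ⟨e, he, ht, hs⟩ => essentialMap_lt_of_separated he ht hs⟩
  by_contra! hc
  by_cases h : ∃ e ∈ D, s ∈ e ∧ t ∉ e
  · obtain ⟨e, he, hs, ht⟩ := h
    exact lt_asymm hlt (essentialMap_lt_of_separated he hs ht)
  · push Not at h
    exact hlt.ne (essentialMap_congr fun e he => ⟨hc e he, h e he⟩)

/-- The hypothesis handles the default value `sInf D`, used when no expert rejects `s`: an expert
rejecting `t` forces `t ∉ sInf D`. -/
theorem mem_lowerExpert_iff {D : Set (LowerSet ℝ)} {t : ℝ} (hD : ∃ e ∈ D, t ∉ e) (s : ℝ) :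
    t ∈ lowerExpert D s ↔ ∃ e ∈ D, t ∈ e ∧ s ∉ e := by
  obtain ⟨e₀, he₀, hte₀⟩ := hD
  unfold lowerExpert
  split_ifs with h
  · simp only [LowerSet.mem_sSup_iff, mem_ofPred_eq, le_Iio_iff]
    exact ⟨fun ⟨e, ⟨h1, h2⟩, h3⟩ => ⟨e, h1, h3, h2⟩, fun ⟨e, h1, h3, h2⟩ => ⟨e, ⟨h1, h2⟩, h3⟩⟩
  · refine ⟨fun ht => absurd (sInf_le he₀ ht) hte₀, fun ⟨e, h1, _, h2⟩ => ?_⟩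
    exact absurd ⟨e, h1, le_Iio_iff.2 h2⟩ h

theorem mem_upperExpert_iff {D : Set (LowerSet ℝ)} {t : ℝ} (hD : ∃ e ∈ D, t ∈ e) (s : ℝ) :
    t ∈ upperExpert D s ↔ ¬ ∃ e ∈ D, s ∈ e ∧ t ∉ e := by
  obtain ⟨e₀, he₀, hte₀⟩ := hD
  push Not
  unfold upperExpert
  split_ifs with h
  · simp only [LowerSet.mem_sInf_iff, mem_ofPred_eq, Iic_le_iff]
    exact ⟨fun H e h1 h2 => H e ⟨h1, h2⟩, fun H e h1 => H e h1.1 h1.2⟩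
  · refine ⟨fun _ e h1 h2 => ?_, fun _ => le_sSup he₀ hte₀⟩
    exact absurd ⟨e, h1, Iic_le_iff.2 h2⟩ h

/-! ### Votes as mean distribution functions of the essential statistic. -/

section Votes

variable {Ω : Type*} [MeasurableSpace Ω] {P : Measure Ω} {T : Ω → ℝ} {D : Set (LowerSet ℝ)}

theorem measurableSet_setOf_mem (t : ℝ) : MeasurableSet {L : LowerSet ℝ | t ∈ L} := by
  have : {L : LowerSet ℝ | t ∈ L} = Ici (LowerSet.Iic t) := by
    ext L
    exact Iic_le_iff.symm
  rw [this]
  exact isClosed_Ici.measurableSet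

/-- The vote is the mean of the probabilities that the two experts attached to an independent
realisation decide `1`. -/
theorem voteOne_eq [IsProbabilityMeasure P] (hT : Measurable T) (ω : Ω) :
    voteOne P T D ω = (P.real {ω' | T ω ∈ lowerExpert D (T ω')} +
      P.real {ω' | T ω ∈ upperExpert D (T ω')}) / 2 := by
  have := isProbabilityMeasure_lowerVoteMeasure (P := P) (D := D) hT
  have := isProbabilityMeasure_upperVoteMeasure (P := P) (D := D) hT
  have h1 : (fun L : LowerSet ℝ => testValue L (T ω)) =
      {L : LowerSet ℝ | T ω ∈ L}.indicator (fun _ => 1) := rfl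
  have hm := measurableSet_setOf_mem (T ω)
  unfold voteOne
  rw [h1, integral_indicator_const _ hm, measureReal_ennreal_smul_apply, measureReal_add_apply]
  have h2 : (lowerVoteMeasure P T D).real {L : LowerSet ℝ | T ω ∈ L} =
      P.real {ω' | T ω ∈ lowerExpert D (T ω')} :=
    map_measureReal_apply (measurable_lowerExpert_comp hT D) hm
  have h3 : (upperVoteMeasure P T D).real {L : LowerSet ℝ | T ω ∈ L} =
      P.real {ω' | T ω ∈ upperExpert D (T ω')} :=
    map_measureReal_apply (measurable_upperExpert_comp hT D) hm
  rw [h2, h3]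
  simp
  ring

theorem voteOne_eq_one [IsProbabilityMeasure P] (hT : Measurable T) (hD : IsClosed D)
    (hne : D.Nonempty) {ω : Ω} (h : ∀ e ∈ D, T ω ∈ e) : voteOne P T D ω = 1 := by
  rw [voteOne_eq hT]
  simp [h _ (lowerExpert_mem hD hne _), h _ (upperExpert_mem hD hne _)]

theorem voteOne_eq_zero [IsProbabilityMeasure P] (hT : Measurable T) (hD : IsClosed D)
    (hne : D.Nonempty) {ω : Ω} (h : ∀ e ∈ D, T ω ∉ e) : voteOne P T D ω = 0 := by
  rw [voteOne_eq hT]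
  simp [h _ (lowerExpert_mem hD hne _), h _ (upperExpert_mem hD hne _)]

/-- Both expert events express separation of `T ω` and `T ω'`, so their complements are the weak and
strict sublevel events of the essential statistic. Averaging the lower and upper votes therefore
produces the mean of the two distribution functions. -/
theorem voteOne_eq_one_sub_meanCDF [IsProbabilityMeasure P] (hT : Measurable T) {ω : Ω}
    (h1 : ∃ e ∈ D, T ω ∈ e) (h0 : ∃ e ∈ D, T ω ∉ e) :
    voteOne P T D ω =
      1 - meanCDF P (fun ω' => essentialMap D (T ω')) (essentialMap D (T ω)) := by
  have e1 : {ω' | essentialMap D (T ω') ≤ essentialMap D (T ω)} =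
      {ω' | T ω ∈ lowerExpert D (T ω')}ᶜ := by
    ext ω'
    simp only [mem_ofPred_eq, mem_compl_iff, mem_lowerExpert_iff h0, ← essentialMap_lt_iff, not_lt]
  have e2 : {ω' | essentialMap D (T ω') < essentialMap D (T ω)} =
      {ω' | T ω ∈ upperExpert D (T ω')}ᶜ := by
    ext ω'
    simp only [mem_ofPred_eq, mem_compl_iff, mem_upperExpert_iff h1, ← essentialMap_lt_iff, not_not]
  have hm := measurableSet_setOf_mem (T ω)
  rw [voteOne_eq hT, meanCDF, e1, e2,
    probReal_compl_eq_one_sub (s := {ω' | T ω ∈ lowerExpert D (T ω')})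
      (measurable_lowerExpert_comp hT D hm),
    probReal_compl_eq_one_sub (s := {ω' | T ω ∈ upperExpert D (T ω')})
      (measurable_upperExpert_comp hT D hm)]
  ring

end Votes

/-! ### Stochastic order from a monotone likelihood ratio. -/

section Model

variable {Ω : Type*} [MeasurableSpace Ω] {Θ : Set ℝ} {μ : Measure Ω} {p : Θ → Ω → ℝ≥0} {T : Ω → ℝ}

theorem IsDominatedModel.isProbabilityMeasure_law (hp : IsDominatedModel μ p) (θ : Θ) :
    IsProbabilityMeasure (law μ p θ) :=
  ⟨by rw [law, withDensity_apply _ MeasurableSet.univ, Measure.restrict_univ,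
    hp.lintegral_eq_one]⟩

theorem IsDominatedModel.ae_density_ne_zero (hp : IsDominatedModel μ p) (θ : Θ) :
    ∀ᵐ ω ∂(law μ p θ), p θ ω ≠ 0 := by
  rw [law, ae_withDensity_iff (hp.measurable θ).coe_nnreal_ennreal]
  exact Eventually.of_forall fun ω hω h0 => hω (by simp [h0])

/-- A monotone likelihood ratio makes the statistic stochastically nondecreasing. -/
theorem IsLikelihoodRatio.law_real_le (hp : IsDominatedModel μ p) (hT : Measurable T) {θ' θ'' : Θ}
    {h : ℝ → ℝ≥0∞} (hh : IsLikelihoodRatio (p θ'') (p θ') T h) (L : LowerSet ℝ) :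
    (law μ p θ'').real {ω | T ω ∈ L} ≤ (law μ p θ').real {ω | T ω ∈ L} := by
  have := hp.isProbabilityMeasure_law θ'
  have := hp.isProbabilityMeasure_law θ''
  have hA : MeasurableSet {ω | T ω ∈ L} := hT L.lower.ordConnected.measurableSet
  set A := {ω | T ω ∈ L} with hAdef
  have hlaw : ∀ θ B, MeasurableSet B → law μ p θ B = ∫⁻ ω in B, (p θ ω : ℝ≥0∞) ∂μ := fun θ B hB =>
    withDensity_apply _ hB
  -- A threshold for the ratio: it is at most `c` on the half-line and at least `c` off it.
  set c := ⨆ s ∈ L, h s with hc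
  have hle : ∀ ω ∈ A, h (T ω) ≤ c := fun ω hω => le_iSup₂ (f := fun s (_ : s ∈ L) => h s) (T ω) hω
  have hge : ∀ ω ∈ Aᶜ, c ≤ h (T ω) := fun ω hω => iSup₂_le fun s hs => hh.monotone <| by
    by_contra hlt
    exact hω (L.lower (not_le.1 hlt).le hs)
  have hcompl : ∀ θ, (law μ p θ).real Aᶜ = 1 - (law μ p θ).real A := fun θ => by
    have := hp.isProbabilityMeasure_law θ
    exact probReal_compl_eq_one_sub hA
  -- An infinite ratio off `A` forces `p θ'` to vanish there, so `P_θ'(A) = 1` and there is nothing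
  -- to compare.
  by_cases hct : c = ∞
  · have h0 : law μ p θ' Aᶜ = 0 := by
      rw [hlaw _ _ hA.compl, setLIntegral_eq_zero_iff hA.compl
        (hp.measurable θ').coe_nnreal_ennreal]
      refine Eventually.of_forall fun ω hω => ?_
      by_contra hne
      have h1 := hh.ratio_eq ω fun h2 => hne (by simp [h2.2])
      have h2 := hge ω hω
      rw [hct, top_le_iff, ← h1, ENNReal.div_eq_top] at h2
      rcases h2 with h2 | h2
      · exact hne h2.2
      · exact ENNReal.coe_ne_top h2.1
    have h1 := hcompl θ'
    rw [measureReal_def, h0, ENNReal.toReal_zero] at h1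
    rw [show (law μ p θ').real A = 1 by linarith]
    exact measureReal_le_one
  · have h1 : law μ p θ'' A ≤ c * law μ p θ' A := by
      rw [hlaw _ _ hA, hlaw _ _ hA, ← lintegral_const_mul _ (hp.measurable θ').coe_nnreal_ennreal]
      refine setLIntegral_mono' hA fun ω hω => ?_
      by_cases hz : p θ'' ω = 0 ∧ p θ' ω = 0
      · simp [hz.1]
      · have h2 := hh.ratio_eq ω hz
        have h3 := hle ω hω
        rw [← h2] at h3
        refine (ENNReal.div_le_iff_le_mul (Or.inl fun h0 => ?_) (Or.inl ENNReal.coe_ne_top)).1 h3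
        have h0' : p θ' ω = 0 := by simpa using h0
        have h4 : p θ'' ω ≠ 0 := fun h5 => hz ⟨h5, h0'⟩
        rw [h0, ENNReal.div_zero (by simpa using h4), top_le_iff] at h3
        exact hct h3
    have h2 : c * law μ p θ' Aᶜ ≤ law μ p θ'' Aᶜ := by
      rw [hlaw _ _ hA.compl, hlaw _ _ hA.compl,
        ← lintegral_const_mul _ (hp.measurable θ').coe_nnreal_ennreal]
      refine setLIntegral_mono' hA.compl fun ω hω => ?_
      by_cases hz : p θ'' ω = 0 ∧ p θ' ω = 0
      · simp [hz.2]
      · have h3 := hge ω hω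
        rw [← hh.ratio_eq ω hz] at h3
        exact ENNReal.mul_le_of_le_div h3
    have h1' := ENNReal.toReal_mono (ENNReal.mul_ne_top hct (measure_ne_top _ _)) h1
    have h2' := ENNReal.toReal_mono (measure_ne_top _ _) h2
    rw [ENNReal.toReal_mul] at h1' h2'
    simp only [← measureReal_def, hcompl] at h1' h2'
    have ha0 : 0 ≤ (law μ p θ').real A := measureReal_nonneg
    have ha1 : (law μ p θ').real A ≤ 1 := measureReal_le_one
    -- For `c ≤ 1` the bound on `A` suffices; for `c ≥ 1` the bound on the complement does.
    rcases le_total c.toReal 1 with h3 | h3 <;> nlinarith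

theorem antitone_meanCDFAt (hp : IsDominatedModel μ p) (hT : Measurable T) (hMLR : IsMLR p T)
    {K : ℝ → EReal} (hK : Monotone K) (t : ℝ) : Antitone (meanCDFAt μ p T K t) := by
  intro θ' θ'' hle
  rcases hle.eq_or_lt with rfl | hlt
  · exact le_rfl
  obtain ⟨h, hh⟩ := hMLR θ' θ'' hlt
  have h1 := hh.law_real_le hp hT ⟨{s | K s < K t}, fun a b hba ha => (hK hba).trans_lt ha⟩
  have h2 := hh.law_real_le hp hT ⟨{s | K s ≤ K t}, fun a b hba ha => (hK hba).trans ha⟩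
  exact div_le_div_of_nonneg_right (add_le_add h1 h2) zero_le_two

theorem meanCDF_mem_Icc (P : Measure Ω) [IsProbabilityMeasure P] (X : Ω → EReal) (k : EReal) :
    meanCDF P X k ∈ Icc 0 1 := by
  have h1 : P.real {ω | X ω < k} ≤ 1 := measureReal_le_one
  have h2 : P.real {ω | X ω ≤ k} ≤ 1 := measureReal_le_one
  unfold meanCDF
  exact ⟨by positivity, by linarith⟩

end Model

/-! ### Unanimity and disagreement of the experts. -/

section Experts

variable {Ω : Type*} {Θ : Set ℝ} {p : Θ → Ω → ℝ≥0} {T : Ω → ℝ} {f : UnilateralHypotheses Θ}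
  {h : Θ → Θ → ℝ → ℝ≥0∞}

theorem exists_simpleTests_le_zero {k : ℝ → ℝ≥0∞} (hk : Monotone k) :
    ∃ L ∈ simpleTests k, ∀ t, t ∈ L ↔ k t = 0 :=
  ⟨⟨{t | k t ≤ 0}, fun _ _ hba ha => (hk hba).trans ha⟩, Or.inl rfl, fun t => nonpos_iff_eq_zero (a := k t)⟩

theorem exists_simpleTests_lt_top {k : ℝ → ℝ≥0∞} (hk : Monotone k) :
    ∃ L ∈ simpleTests k, ∀ t, t ∈ L ↔ k t < ∞ :=
  ⟨⟨{t | k t < ∞}, fun _ _ hba ha => (hk hba).trans_lt ha⟩, Or.inr (Or.inr rfl), fun _ => Iff.rfl⟩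

theorem mem_of_mem_simpleTests {k : ℝ → ℝ≥0∞} {L : LowerSet ℝ} (hL : L ∈ simpleTests k) {t : ℝ}
    (ht : k t = 0) : t ∈ L := by
  change t ∈ (L : Set ℝ)
  rcases hL with h | ⟨c, h0, h1, h | h⟩ | h <;> simp [h, ht]
  exact h0

theorem notMem_of_mem_simpleTests {k : ℝ → ℝ≥0∞} {L : LowerSet ℝ} (hL : L ∈ simpleTests k) {t : ℝ}
    (ht : k t = ∞) : t ∉ L := by
  change t ∉ (L : Set ℝ)
  rcases hL with h | ⟨c, h0, h1, h | h⟩ | h <;> simp [h, ht]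
  exact h1.ne

theorem IsNormalizedFamily.nonempty_experts (hh : IsNormalizedFamily p T f h) :
    (experts f h).Nonempty := by
  obtain ⟨θ₀, h0⟩ := f.zero_nonempty
  obtain ⟨θ₁, h1⟩ := f.one_nonempty
  obtain ⟨L, hL, -⟩ := exists_simpleTests_le_zero (hh.isLikelihoodRatio θ₀ h0 θ₁ h1).monotone
  exact ⟨L, subset_closure ⟨θ₀, h0, θ₁, h1, hL⟩⟩

theorem IsNormalizedFamily.mem_expert (hh : IsNormalizedFamily p T f h) {t : ℝ}
    (ht : t ∈ lowerNull p T f.zero \ upperNull p T f.one) : ∀ e ∈ experts f h, t ∈ e := by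
  -- Deciding `1` at `t` is a closed condition on the half-line, so it passes from the simple tests
  -- to their closure.
  have hsub : experts f h ⊆ Ici (LowerSet.Iic t) := closure_minimal (by
    rintro L ⟨θ₀, h0, θ₁, h1, hL⟩
    exact Iic_le_iff.2 (mem_of_mem_simpleTests hL (hh.eq_zero θ₀ h0 θ₁ h1 t ht))) isClosed_Ici
  exact fun e he => Iic_le_iff.1 (hsub he)

theorem IsNormalizedFamily.notMem_expert (hh : IsNormalizedFamily p T f h) {t : ℝ}
    (ht : t ∈ upperNull p T f.one) : ∀ e ∈ experts f h, t ∉ e := by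
  have hsub : experts f h ⊆ Iic (LowerSet.Iio t) := closure_minimal (by
    rintro L ⟨θ₀, h0, θ₁, h1, hL⟩
    exact le_Iio_iff.2 (notMem_of_mem_simpleTests hL (hh.eq_top θ₀ h0 θ₁ h1 t ht))) isClosed_Iic
  exact fun e he => le_Iio_iff.1 (hsub he)

/-- A point at or below `t` carries a positive density `p θ₀`, so the ratio is positive there and,
by monotonicity, at `t`; the test `{h ≤ 0}` then rejects `t`. -/
theorem IsNormalizedFamily.exists_notMem_expert (hh : IsNormalizedFamily p T f h) {t : ℝ}
    (ht : t ∉ lowerNull p T f.zero) : ∃ e ∈ experts f h, t ∉ e := by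
  simp only [lowerNull, mem_ofPred_eq] at ht
  push Not at ht
  obtain ⟨ω, hω, θ₀, h0, hne⟩ := ht
  obtain ⟨θ₁, h1⟩ := f.one_nonempty
  have hr := hh.isLikelihoodRatio θ₀ h0 θ₁ h1
  obtain ⟨L, hL, hiff⟩ := exists_simpleTests_le_zero hr.monotone
  refine ⟨L, subset_closure ⟨θ₀, h0, θ₁, h1, hL⟩, fun hmem => ?_⟩
  have h2 := hr.ratio_eq ω fun h3 => hne h3.1
  rw [(hiff _).1 (L.lower hω hmem), ENNReal.div_eq_zero_iff] at h2
  rcases h2 with h2 | h2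
  · exact hne (by simpa using h2)
  · exact ENNReal.coe_ne_top h2

theorem IsNormalizedFamily.exists_mem_expert (hh : IsNormalizedFamily p T f h) {t : ℝ}
    (ht : t ∉ upperNull p T f.one) : ∃ e ∈ experts f h, t ∈ e := by
  simp only [upperNull, mem_ofPred_eq] at ht
  push Not at ht
  obtain ⟨ω, hω, θ₁, h1, hne⟩ := ht
  obtain ⟨θ₀, h0⟩ := f.zero_nonempty
  have hr := hh.isLikelihoodRatio θ₀ h0 θ₁ h1
  obtain ⟨L, hL, hiff⟩ := exists_simpleTests_lt_top hr.monotone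
  refine ⟨L, subset_closure ⟨θ₀, h0, θ₁, h1, hL⟩, (hiff t).2 ((hr.monotone hω).trans_lt ?_)⟩
  rw [← hr.ratio_eq ω fun h3 => hne h3.2]
  exact ENNReal.div_lt_top ENNReal.coe_ne_top (by simpa using hne)

end Experts

/-! ### Reduction to a single antitone function on the parameter interval. -/

/-- The values, at a point `t`, of the votes `V f θ` under `P_θ` in favour of `Θ₁^f` and of the
global mean distribution functions `g θ = G_θ(K(t))`. -/
structure IsVoteProfile {Ω : Type*} {Θ : Set ℝ} (p : Θ → Ω → ℝ≥0) (T : Ω → ℝ) (t : ℝ)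
    (g : Θ → ℝ) (V : UnilateralHypotheses Θ → Θ → ℝ) : Prop where
  notMem_nullPoints : t ∉ nullPoints p T
  antitone : Antitone g
  mem_Icc : ∀ θ, g θ ∈ Icc 0 1
  eq_zero : ∀ f : UnilateralHypotheses Θ, t ∈ lowerNull p T f.zero → ∀ θ ∈ f.zero, g θ = 0
  eq_one : ∀ f : UnilateralHypotheses Θ, t ∈ upperNull p T f.one → ∀ θ ∈ f.one, g θ = 1
  vote_one : ∀ f, t ∈ lowerNull p T f.zero → ∀ θ, V f θ = 1
  vote_zero : ∀ f, t ∈ upperNull p T f.one → ∀ θ, V f θ = 0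
  vote_eq : ∀ f, t ∉ lowerNull p T f.zero → t ∉ upperNull p T f.one → ∀ θ, V f θ = 1 - g θ

/-- In both zones at once, the two hypotheses together would make every density vanish over `t`. Off
`N`, the priority given to `+∞` in the normalisation is thus immaterial. -/
theorem notMem_upperNull_of_mem_lowerNull {Ω : Type*} {Θ : Set ℝ} {p : Θ → Ω → ℝ≥0} {T : Ω → ℝ}
    {t : ℝ} (hN : t ∉ nullPoints p T) {f : UnilateralHypotheses Θ}
    (hlo : t ∈ lowerNull p T f.zero) : t ∉ upperNull p T f.one := fun hup =>
  hN fun ω hω θ => by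
    rcases (f.isCompl.sup_eq_top.ge (mem_univ θ) : θ ∈ f.one ∪ f.zero) with h | h
    · exact hup ω hω.ge θ h
    · exact hlo ω hω.le θ h

theorem isVoteProfile {Ω : Type*} [MeasurableSpace Ω] {Θ : Set ℝ} {μ : Measure Ω}
    {p : Θ → Ω → ℝ≥0} {T : Ω → ℝ} (hp : IsDominatedModel μ p) (hT : Measurable T)
    (hMLR : IsMLR p T) {h : UnilateralHypotheses Θ → Θ → Θ → ℝ → ℝ≥0∞}
    (hh : ∀ f, IsNormalizedFamily p T f (h f)) {K : ℝ → EReal}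
    (hK : IsGlobalEssential μ p T h K) {ω : Ω} (hN : T ω ∉ nullPoints p T) :
    IsVoteProfile p T (T ω) (meanCDFAt μ p T K (T ω))
      (fun f θ => voteOne (law μ p θ) T (experts f (h f)) ω) where
  notMem_nullPoints := hN
  antitone := antitone_meanCDFAt hp hT hMLR hK.monotone _
  mem_Icc θ := by
    have := hp.isProbabilityMeasure_law θ
    exact meanCDF_mem_Icc _ _ _
  eq_zero f hf := hK.eq_zero f _ ⟨hf, hN⟩
  eq_one f hf := hK.eq_one f _ ⟨hf, hN⟩
  vote_one f hf θ := by
    have := hp.isProbabilityMeasure_law θ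
    exact voteOne_eq_one hT isClosed_closure (hh f).nonempty_experts
      ((hh f).mem_expert ⟨hf, notMem_upperNull_of_mem_lowerNull hN hf⟩)
  vote_zero f hf θ := by
    have := hp.isProbabilityMeasure_law θ
    exact voteOne_eq_zero hT isClosed_closure (hh f).nonempty_experts ((hh f).notMem_expert hf)
  vote_eq f hlo hup θ := by
    have := hp.isProbabilityMeasure_law θ
    rw [hK.eq_essential f _ (by simp only [mem_union, not_or]; exact ⟨⟨hlo, hup⟩, hN⟩) θ]
    exact voteOne_eq_one_sub_meanCDF hT ((hh f).exists_mem_expert hup)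
      ((hh f).exists_notMem_expert hlo)

/-! ### Ordered partitions of an interval. -/

section Cuts

variable {Θ : Set ℝ}

theorem UnilateralHypotheses.mem_one_or_mem_zero (f : UnilateralHypotheses Θ) (θ : Θ) :
    θ ∈ f.one ∨ θ ∈ f.zero :=
  (f.isCompl.sup_eq_top.ge (mem_univ θ) : θ ∈ f.one ∪ f.zero)

theorem UnilateralHypotheses.notMem_one_iff (f : UnilateralHypotheses Θ) {θ : Θ} :
    θ ∉ f.one ↔ θ ∈ f.zero :=
  ⟨(f.mem_one_or_mem_zero θ).resolve_left, fun h0 h1 => lt_irrefl _ (f.lt θ h1 θ h0)⟩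

theorem UnilateralHypotheses.isLowerSet_one (f : UnilateralHypotheses Θ) : IsLowerSet f.one :=
  fun a b hba ha => by
    by_contra hb
    exact absurd (f.lt a ha b (f.notMem_one_iff.1 hb)) hba.not_gt

theorem UnilateralHypotheses.zero_eq_compl (f : UnilateralHypotheses Θ) : f.zero = f.oneᶜ := by
  ext θ
  exact f.notMem_one_iff.symm

theorem UnilateralHypotheses.zero_subset_zero {f f' : UnilateralHypotheses Θ}
    (h : f.one ⊆ f'.one) : f'.zero ⊆ f.zero := by
  rw [f.zero_eq_compl, f'.zero_eq_compl]
  exact compl_subset_compl.2 h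

/-- The hypotheses given by a nontrivial lower set. -/
def UnilateralHypotheses.ofLowerSet (S : Set Θ) (hS : IsLowerSet S) (h1 : S.Nonempty)
    (h0 : Sᶜ.Nonempty) : UnilateralHypotheses Θ where
  one := S
  zero := Sᶜ
  isCompl := isCompl_compl
  one_nonempty := h1
  zero_nonempty := h0
  lt θ₁ hθ₁ θ₀ hθ₀ := by
    by_contra hlt
    exact hθ₀ (hS (not_lt.1 hlt) hθ₁)

/-- The hypotheses `{θ ≤ a}` and `{θ > a}`. -/
def UnilateralHypotheses.ofIic {a b : Θ} (hab : a < b) : UnilateralHypotheses Θ :=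
  .ofLowerSet (Iic a) (isLowerSet_Iic a) ⟨a, le_refl a⟩ ⟨b, hab.not_ge⟩

/-- The hypotheses `{θ < a}` and `{θ ≥ a}`. -/
def UnilateralHypotheses.ofIio {a b : Θ} (hba : b < a) : UnilateralHypotheses Θ :=
  .ofLowerSet (Iio a) (isLowerSet_Iio a) ⟨b, hba⟩ ⟨a, lt_irrefl a⟩

@[simp] theorem UnilateralHypotheses.ofIic_one {a b : Θ} (hab : a < b) :
    (ofIic hab).one = Iic a := rfl

@[simp] theorem UnilateralHypotheses.ofIic_zero {a b : Θ} (hab : a < b) :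
    (ofIic hab).zero = Ioi a := compl_Iic

@[simp] theorem UnilateralHypotheses.ofIio_one {a b : Θ} (hba : b < a) :
    (ofIio hba).one = Iio a := rfl

@[simp] theorem UnilateralHypotheses.ofIio_zero {a b : Θ} (hba : b < a) :
    (ofIio hba).zero = Ici a := compl_Iio

theorem UnilateralHypotheses.exists_eq_Iic_or_Iio [hΘ : Θ.OrdConnected]
    (f : UnilateralHypotheses Θ) :
    ∃ a, (f.one = Iic a ∧ f.zero = Ioi a) ∨ (f.one = Iio a ∧ f.zero = Ici a) := by
  obtain ⟨θ₁, h1⟩ := f.one_nonempty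
  obtain ⟨θ₀, h0⟩ := f.zero_nonempty
  set s := sSup (Subtype.val '' f.one)
  have hbdd : ∀ θ ∈ f.zero, ∀ x ∈ Subtype.val '' f.one, x ≤ (θ : ℝ) := by
    rintro θ hθ _ ⟨x, hx, rfl⟩
    exact (f.lt x hx θ hθ).le
  have hle : ∀ θ ∈ f.one, (θ : ℝ) ≤ s := fun θ hθ =>
    le_csSup ⟨θ₀, hbdd θ₀ h0⟩ (mem_image_of_mem _ hθ)
  have hge : ∀ θ ∈ f.zero, s ≤ (θ : ℝ) := fun θ hθ =>
    csSup_le ⟨_, mem_image_of_mem _ h1⟩ (hbdd θ hθ)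
  -- This is where `Θ` being an interval matters: the supremum of the lower part is itself a
  -- parameter, on one side or the other of the cut.
  have hs : s ∈ Θ := hΘ.out θ₁.2 θ₀.2 ⟨hle θ₁ h1, hge θ₀ h0⟩
  refine ⟨⟨s, hs⟩, ?_⟩
  rcases f.mem_one_or_mem_zero ⟨s, hs⟩ with h | h
  · have h2 : f.one = Iic ⟨s, hs⟩ :=
      Subset.antisymm (fun θ hθ => hle θ hθ) fun θ hθ => f.isLowerSet_one hθ h
    exact Or.inl ⟨h2, by rw [f.zero_eq_compl, h2, compl_Iic]⟩
  · have h2 : f.zero = Ici ⟨s, hs⟩ :=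
      Subset.antisymm (fun θ hθ => hge θ hθ) fun θ hθ => f.notMem_one_iff.1 fun h3 =>
        absurd (f.lt θ h3 _ h) (not_lt.2 hθ)
    refine Or.inr ⟨?_, h2⟩
    rw [← compl_compl f.one, ← f.zero_eq_compl, h2, compl_Ici]

end Cuts

/-! ### Probabilities determined by their values on cuts. -/

section Extension

variable {Θ : Set ℝ}

theorem Iic_eq_univ_or_exists_ofIic (a : Θ) :
    Iic a = univ ∨ ∃ f : UnilateralHypotheses Θ, f.one = Iic a := by
  by_cases h : ∃ b, a < b
  · obtain ⟨b, hb⟩ := h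
    exact Or.inr ⟨.ofIic hb, rfl⟩
  · push Not at h
    exact Or.inl (eq_univ_of_forall h)

theorem measurable_of_measurableSet_preimage_one [Θ.OrdConnected] {α : Type*}
    [MeasurableSpace α] {φ : α → Θ}
    (h : ∀ f : UnilateralHypotheses Θ, MeasurableSet (φ ⁻¹' f.one)) : Measurable φ := by
  refine measurable_of_Iic fun a => ?_
  rcases Iic_eq_univ_or_exists_ofIic a with ha | ⟨f, hf⟩
  · rw [ha]; exact MeasurableSet.univ
  · rw [← hf]; exact h f

theorem UnilateralHypotheses.measurableSet_one [Θ.OrdConnected]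
    (f : UnilateralHypotheses Θ) : MeasurableSet f.one :=
  f.isLowerSet_one.ordConnected.measurableSet

theorem IsProbabilityExtension.unique [Θ.OrdConnected] {Q : UnilateralHypotheses Θ → ℝ}
    {ν ν' : Measure Θ} (h : IsProbabilityExtension Q ν) (h' : IsProbabilityExtension Q ν') :
    ν = ν' := by
  have := h.isProbabilityMeasure
  have := h'.isProbabilityMeasure
  refine Measure.ext_of_Iic _ _ fun a => ?_
  rcases Iic_eq_univ_or_exists_ofIic a with ha | ⟨f, hf⟩
  · rw [ha, measure_univ, measure_univ]
  · rw [← hf, ← measureReal_eq_measureReal_iff, h.real_one, h'.real_one]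

/-- A quantile function yields a probability extension. -/
theorem exists_isProbabilityExtension [Θ.OrdConnected] {Q : UnilateralHypotheses Θ → ℝ}
    (hQ : ∀ f, Q f ∈ Icc 0 1)
    (h : ∀ u ∈ Ioo (0 : ℝ) 1, ∃ θ, ∀ f, (u < Q f → θ ∈ f.one) ∧ (Q f < u → θ ∈ f.zero)) :
    ∃ ν, IsProbabilityExtension Q ν := by
  choose φ hφ using h
  set ψ : Ioo (0 : ℝ) 1 → Θ := fun u => φ u u.2
  have hψ1 : ∀ (u : Ioo (0 : ℝ) 1) f, (u : ℝ) < Q f → ψ u ∈ f.one := fun u f => (hφ u u.2 f).1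
  have hψ0 : ∀ (u : Ioo (0 : ℝ) 1) f, ψ u ∈ f.one → (u : ℝ) ≤ Q f := fun u f h1 => by
    by_contra hlt
    exact f.notMem_one_iff.2 ((hφ u u.2 f).2 (not_le.1 hlt)) h1
  have hψ : Measurable ψ := by
    refine measurable_of_measurableSet_preimage_one fun f => ?_
    -- The chosen quantiles need not be monotone in the level for this: `ψ u ∈ f.one` gives `u ≤ Q
    -- f`, so any smaller level lies strictly below `Q f`.
    have hl : IsLowerSet (ψ ⁻¹' f.one) := by
      intro u v hvu hu
      rcases hvu.eq_or_lt with rfl | hlt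
      · exact hu
      · exact hψ1 v f (lt_of_lt_of_le hlt (hψ0 u f hu))
    exact hl.ordConnected.measurableSet
  set lam : Measure (Ioo (0 : ℝ) 1) := Measure.comap Subtype.val volume with hlam
  have hlam_apply : ∀ s, lam s = volume (Subtype.val '' s) := fun s =>
    comap_subtype_coe_apply measurableSet_Ioo _ s
  have hprob : IsProbabilityMeasure lam := ⟨by
    rw [hlam_apply, image_univ, Subtype.range_coe]; simp⟩
  refine ⟨lam.map ψ, ⟨Measure.isProbabilityMeasure_map hψ.aemeasurable, fun f => ?_⟩⟩
  rw [map_measureReal_apply hψ (f.measurableSet_one), measureReal_def, hlam_apply]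
  -- The preimage of the cut lies between `(0, Q f)` and `(0, Q f]`, so the ambiguity at the level
  -- `Q f` is null.
  have h1 : volume (Subtype.val '' (ψ ⁻¹' f.one)) = ENNReal.ofReal (Q f) := by
    refine le_antisymm ?_ ?_
    · have : Subtype.val '' (ψ ⁻¹' f.one) ⊆ Ioc 0 (Q f) := by
        rintro _ ⟨u, hu, rfl⟩
        exact ⟨u.2.1, hψ0 u f hu⟩
      simpa using measure_mono (μ := volume) this
    · have : Ioo 0 (Q f) ⊆ Subtype.val '' (ψ ⁻¹' f.one) := fun u hu =>
        ⟨⟨u, hu.1, hu.2.trans_le (hQ f).2⟩, hψ1 _ f hu.2, rfl⟩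
      simpa using measure_mono (μ := volume) this
  rw [h1, ENNReal.toReal_ofReal (hQ f).1]

theorem IsProbabilityExtension.isCompatibleAt [Θ.OrdConnected]
    {Q : UnilateralHypotheses Θ → ℝ} {ν : Measure Θ} (h : IsProbabilityExtension Q ν) :
    IsCompatibleAt Q := by
  have := h.isProbabilityMeasure
  have hinc : ∀ f : ℕ → UnilateralHypotheses Θ, Monotone (fun n => (f n).one) →
      Tendsto (fun n => Q (f n)) atTop (𝓝 (ν.real (⋃ n, (f n).one))) := fun f hf => by
    simp_rw [← h.real_one]
    exact (ENNReal.tendsto_toReal (measure_ne_top _ _)).comp (tendsto_measure_iUnion_atTop hf)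
  have hdec : ∀ f : ℕ → UnilateralHypotheses Θ, Antitone (fun n => (f n).one) →
      Tendsto (fun n => Q (f n)) atTop (𝓝 (ν.real (⋂ n, (f n).one))) := fun f hf => by
    simp_rw [← h.real_one]
    exact (ENNReal.tendsto_toReal (measure_ne_top _ _)).comp (tendsto_measure_iInter_atTop
      (fun n => ((f n).measurableSet_one).nullMeasurableSet) hf ⟨0, measure_ne_top _ _⟩)
  refine ⟨fun f f' hff => ?_, fun f hf hu => ?_, fun f hf hi => ?_, fun f f' hf hf' he => ?_⟩
  · rw [← h.real_one, ← h.real_one]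
    exact measureReal_mono hff.subset
  · simpa [hu] using hinc f hf
  · simpa [hi] using hdec f hf
  · exact ⟨_, hinc f hf, he ▸ hdec f' hf'⟩

end Extension

/-! ### The two most favourable votes at a point. -/

theorem lowerNull_anti {Ω : Type*} {Θ : Set ℝ} {p : Θ → Ω → ℝ≥0} {T : Ω → ℝ} {A B : Set Θ}
    (h : A ⊆ B) : lowerNull p T B ⊆ lowerNull p T A := fun _ ht ω hω θ hθ => ht ω hω θ (h hθ)

theorem upperNull_anti {Ω : Type*} {Θ : Set ℝ} {p : Θ → Ω → ℝ≥0} {T : Ω → ℝ} {A B : Set Θ}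
    (h : A ⊆ B) : upperNull p T B ⊆ upperNull p T A := fun _ ht ω hω θ hθ => ht ω hω θ (h hθ)

/-- One parameter witnesses the non-vanishing, and it serves every set containing it. Moving a cut
while keeping this parameter on its side thus never enters the degenerate zone. -/
theorem exists_notMem_lowerNull {Ω : Type*} {Θ : Set ℝ} {p : Θ → Ω → ℝ≥0} {T : Ω → ℝ} {A : Set Θ}
    {t : ℝ} (h : t ∉ lowerNull p T A) : ∃ θ ∈ A, ∀ B : Set Θ, θ ∈ B → t ∉ lowerNull p T B := by
  simp only [lowerNull, mem_ofPred_eq] at h ⊢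
  push Not at h
  obtain ⟨ω, hω, θ, hθ, hne⟩ := h
  exact ⟨θ, hθ, fun B hB hB' => hne (hB' ω hω θ hB)⟩

theorem exists_notMem_upperNull {Ω : Type*} {Θ : Set ℝ} {p : Θ → Ω → ℝ≥0} {T : Ω → ℝ} {A : Set Θ}
    {t : ℝ} (h : t ∉ upperNull p T A) : ∃ θ ∈ A, ∀ B : Set Θ, θ ∈ B → t ∉ upperNull p T B := by
  simp only [upperNull, mem_ofPred_eq] at h ⊢
  push Not at h
  obtain ⟨ω, hω, θ, hθ, hne⟩ := h
  exact ⟨θ, hθ, fun B hB hB' => hne (hB' ω hω θ hB)⟩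

theorem notMem_lowerNull_univ {Ω : Type*} {Θ : Set ℝ} {p : Θ → Ω → ℝ≥0} {T : Ω → ℝ} {t : ℝ}
    (h : t ∉ nullPoints p T) : t ∉ lowerNull p T univ :=
  fun h' => h fun ω hω θ => h' ω hω.le θ (mem_univ θ)

theorem notMem_upperNull_univ {Ω : Type*} {Θ : Set ℝ} {p : Θ → Ω → ℝ≥0} {T : Ω → ℝ} {t : ℝ}
    (h : t ∉ nullPoints p T) : t ∉ upperNull p T univ :=
  fun h' => h fun ω hω θ => h' ω hω.ge θ (mem_univ θ)

/-- The largest vote in favour of `Θ₁` under an element of `Θ₁`. -/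
noncomputable def supVoteOne {Θ : Set ℝ} (V : UnilateralHypotheses Θ → Θ → ℝ)
    (f : UnilateralHypotheses Θ) : ℝ := ⨆ θ : f.one, V f θ

/-- The complement of the largest vote in favour of `Θ₀` under an element of `Θ₀`. -/
noncomputable def infVoteOne {Θ : Set ℝ} (V : UnilateralHypotheses Θ → Θ → ℝ)
    (f : UnilateralHypotheses Θ) : ℝ := 1 - ⨆ θ : f.zero, (1 - V f θ)

namespace IsVoteProfile

variable {Ω : Type*} {Θ : Set ℝ} {p : Θ → Ω → ℝ≥0} {T : Ω → ℝ} {t : ℝ} {g : Θ → ℝ}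
  {V : UnilateralHypotheses Θ → Θ → ℝ} {f f' : UnilateralHypotheses Θ}

theorem vote_mem_Icc (hV : IsVoteProfile p T t g V) (f : UnilateralHypotheses Θ) (θ : Θ) :
    V f θ ∈ Icc 0 1 := by
  by_cases hlo : t ∈ lowerNull p T f.zero
  · simp [hV.vote_one f hlo θ]
  by_cases hup : t ∈ upperNull p T f.one
  · simp [hV.vote_zero f hup θ]
  · rw [hV.vote_eq f hlo hup θ]
    have := hV.mem_Icc θ
    exact ⟨by linarith [this.2], by linarith [this.1]⟩

theorem bddAbove_vote (hV : IsVoteProfile p T t g V) (f : UnilateralHypotheses Θ) :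
    BddAbove (range fun θ : f.one => V f θ) :=
  ⟨1, forall_mem_range.2 fun θ => (hV.vote_mem_Icc f θ).2⟩

theorem bddAbove_one_sub_vote (hV : IsVoteProfile p T t g V) (f : UnilateralHypotheses Θ) :
    BddAbove (range fun θ : f.zero => 1 - V f θ) :=
  ⟨1, forall_mem_range.2 fun θ => by linarith [(hV.vote_mem_Icc f θ).1]⟩

theorem supVoteOne_mem_Icc (hV : IsVoteProfile p T t g V) (f : UnilateralHypotheses Θ) :
    supVoteOne V f ∈ Icc 0 1 := by
  obtain ⟨θ, hθ⟩ := f.one_nonempty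
  have : Nonempty f.one := ⟨⟨θ, hθ⟩⟩
  exact ⟨(hV.vote_mem_Icc f θ).1.trans (le_ciSup (hV.bddAbove_vote f) ⟨θ, hθ⟩),
    ciSup_le fun θ => (hV.vote_mem_Icc f θ).2⟩

theorem supVoteOne_of_mem_lowerNull (hV : IsVoteProfile p T t g V)
    (h : t ∈ lowerNull p T f.zero) : supVoteOne V f = 1 := by
  have : Nonempty f.one := f.one_nonempty.to_subtype
  simp [supVoteOne, hV.vote_one f h]

theorem infVoteOne_of_mem_lowerNull (hV : IsVoteProfile p T t g V)
    (h : t ∈ lowerNull p T f.zero) : infVoteOne V f = 1 := by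
  have : Nonempty f.zero := f.zero_nonempty.to_subtype
  simp [infVoteOne, hV.vote_one f h]

theorem supVoteOne_of_mem_upperNull (hV : IsVoteProfile p T t g V)
    (h : t ∈ upperNull p T f.one) : supVoteOne V f = 0 := by
  have : Nonempty f.one := f.one_nonempty.to_subtype
  simp [supVoteOne, hV.vote_zero f h]

theorem infVoteOne_of_mem_upperNull (hV : IsVoteProfile p T t g V)
    (h : t ∈ upperNull p T f.one) : infVoteOne V f = 0 := by
  have : Nonempty f.zero := f.zero_nonempty.to_subtype
  simp [infVoteOne, hV.vote_zero f h]

/-- The extreme zones give the values `1` and `0`, which compare trivially. Otherwise both votes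
equal `1 - g θ`, and the supremum is taken over a larger set. -/
theorem supVoteOne_mono (hV : IsVoteProfile p T t g V) (hff : f.one ⊆ f'.one) :
    supVoteOne V f ≤ supVoteOne V f' := by
  by_cases hlo' : t ∈ lowerNull p T f'.zero
  · rw [hV.supVoteOne_of_mem_lowerNull hlo']
    exact (hV.supVoteOne_mem_Icc f).2
  by_cases hup : t ∈ upperNull p T f.one
  · rw [hV.supVoteOne_of_mem_upperNull hup]
    exact (hV.supVoteOne_mem_Icc f').1
  have hlo : t ∉ lowerNull p T f.zero := fun h =>
    hlo' (lowerNull_anti (UnilateralHypotheses.zero_subset_zero hff) h)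
  have hup' : t ∉ upperNull p T f'.one := fun h => hup (upperNull_anti hff h)
  have : Nonempty f.one := f.one_nonempty.to_subtype
  refine ciSup_le fun θ => ?_
  rw [hV.vote_eq f hlo hup, ← hV.vote_eq f' hlo' hup']
  exact le_ciSup (hV.bddAbove_vote f') ⟨θ, hff θ.2⟩

theorem supVoteOne_of_one_eq_Iic (hV : IsVoteProfile p T t g V) {a : Θ} (ha : f.one = Iic a)
    (hlo : t ∉ lowerNull p T f.zero) : supVoteOne V f = 1 - g a := by
  have hmem : a ∈ f.one := ha ▸ self_mem_Iic
  by_cases hup : t ∈ upperNull p T f.one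
  · rw [hV.supVoteOne_of_mem_upperNull hup, hV.eq_one f hup a hmem, sub_self]
  have : Nonempty f.one := ⟨⟨a, hmem⟩⟩
  refine le_antisymm (ciSup_le fun θ => ?_) ?_
  · rw [hV.vote_eq f hlo hup]
    have : (θ : Θ) ≤ a := (ha ▸ θ.2 : (θ : Θ) ∈ Iic a)
    linarith [hV.antitone this]
  · rw [← hV.vote_eq f hlo hup]
    exact le_ciSup (hV.bddAbove_vote f) ⟨a, hmem⟩

theorem infVoteOne_of_zero_eq_Ici (hV : IsVoteProfile p T t g V) {a : Θ} (ha : f.zero = Ici a)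
    (hup : t ∉ upperNull p T f.one) : infVoteOne V f = 1 - g a := by
  have hmem : a ∈ f.zero := ha ▸ self_mem_Ici
  by_cases hlo : t ∈ lowerNull p T f.zero
  · rw [hV.infVoteOne_of_mem_lowerNull hlo, hV.eq_zero f hlo a hmem, sub_zero]
  have : Nonempty f.zero := ⟨⟨a, hmem⟩⟩
  unfold infVoteOne
  congr 1
  refine le_antisymm (ciSup_le fun θ => ?_) ?_
  · rw [hV.vote_eq f hlo hup]
    have : a ≤ (θ : Θ) := (ha ▸ θ.2 : (θ : Θ) ∈ Ici a)
    linarith [hV.antitone this]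
  · refine le_trans ?_ (le_ciSup (hV.bddAbove_one_sub_vote f) ⟨a, hmem⟩)
    rw [hV.vote_eq f hlo hup]
    simp


end IsVoteProfile

/-- The four regularity conditions for a function `g` on `Θ`. -/
structure IsRegularProfile {Ω : Type*} {Θ : Set ℝ} (p : Θ → Ω → ℝ≥0) (T : Ω → ℝ) (t : ℝ)
    (g : Θ → ℝ) : Prop where
  right_continuous : ∀ θf : Θ, ¬ IsGreatest Θ θf → t ∉ lowerNull p T {θ | θf < θ} →
    ContinuousWithinAt g (Ici θf) θf
  left_continuous : ∀ θf : Θ, ¬ IsLeast Θ θf → t ∉ upperNull p T {θ | θ < θf} →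
    ContinuousWithinAt g (Iic θf) θf
  tendsto_inf : (¬ ∃ a, IsLeast Θ a) → Tendsto g atBot (𝓝 1)
  tendsto_sup : (¬ ∃ b, IsGreatest Θ b) → Tendsto g atTop (𝓝 0)

theorem not_isGreatest_of_lt {Θ : Set ℝ} {a b : Θ} (h : a < b) : ¬ IsGreatest Θ a := fun ha =>
  absurd (ha.2 b.2) (not_le.2 h)

theorem not_isLeast_of_lt {Θ : Set ℝ} {a b : Θ} (h : b < a) : ¬ IsLeast Θ a := fun ha =>
  absurd (ha.2 b.2) (not_le.2 h)

theorem exists_gt_of_not_isGreatest {Θ : Set ℝ} {a : Θ} (h : ¬ IsGreatest Θ a) : ∃ b, a < b := by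
  by_contra! hc
  exact h ⟨a.2, fun x hx => hc ⟨x, hx⟩⟩

theorem exists_lt_of_not_isLeast {Θ : Set ℝ} {a : Θ} (h : ¬ IsLeast Θ a) : ∃ b, b < a := by
  by_contra! hc
  exact h ⟨a.2, fun x hx => hc ⟨x, hx⟩⟩

/-! ### From regularity to a probability extending the votes. -/

section Regular

variable {Ω : Type*} {Θ : Set ℝ} {p : Θ → Ω → ℝ≥0} {T : Ω → ℝ} {t : ℝ} {g : Θ → ℝ}
  {V : UnilateralHypotheses Θ → Θ → ℝ}

/-- Right-continuity gives, beyond `a`, hypotheses `{θ ≤ b}` of vote below a given level. -/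
theorem IsRegularProfile.exists_gt_lt [Θ.OrdConnected] (hg : IsRegularProfile p T t g) {a : Θ}
    (ha : t ∉ lowerNull p T (Ioi a)) {v : ℝ} (hv : v < g a) :
    ∃ b, ∃ c, ∃ _ : b < c, a < b ∧ v < g b ∧ t ∉ lowerNull p T (Ioi b) := by
  obtain ⟨c, hac, hc⟩ := exists_notMem_lowerNull ha
  have h1 : ∀ᶠ b in 𝓝[>] a, v < g b :=
    (hg.right_continuous a (not_isGreatest_of_lt hac) ha).mono_left
      (nhdsWithin_mono a Ioi_subset_Ici_self) |>.eventually (lt_mem_nhds hv)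
  have h2 : ∀ᶠ b in 𝓝[>] a, b < c := nhdsWithin_le_nhds (gt_mem_nhds hac)
  have : (𝓝[>] a).NeBot := nhdsGT_neBot_of_exists_gt ⟨c, hac⟩
  obtain ⟨b, ⟨hb1, hb2⟩, hb3⟩ := ((h1.and h2).and self_mem_nhdsWithin).exists
  exact ⟨b, c, hb2, hb3, hb1, hc _ hb2⟩

theorem IsRegularProfile.exists_lt_gt [Θ.OrdConnected] (hg : IsRegularProfile p T t g) {a : Θ}
    (ha : t ∉ upperNull p T (Iio a)) {v : ℝ} (hv : g a < v) :
    ∃ b, ∃ c, ∃ _ : c < b, b < a ∧ g b < v ∧ t ∉ upperNull p T (Iio b) := by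
  obtain ⟨c, hca, hc⟩ := exists_notMem_upperNull ha
  have h1 : ∀ᶠ b in 𝓝[<] a, g b < v :=
    (hg.left_continuous a (not_isLeast_of_lt hca) ha).mono_left
      (nhdsWithin_mono a Iio_subset_Iic_self) |>.eventually (gt_mem_nhds hv)
  have h2 : ∀ᶠ b in 𝓝[<] a, c < b := nhdsWithin_le_nhds (lt_mem_nhds hca)
  have : (𝓝[<] a).NeBot := nhdsLT_neBot_of_exists_lt ⟨c, hca⟩
  obtain ⟨b, ⟨hb1, hb2⟩, hb3⟩ := ((h1.and h2).and self_mem_nhdsWithin).exists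
  exact ⟨b, c, hb2, hb3, hb1, hc _ hb2⟩

/-- Under the regularity conditions both most favourable votes coincide. -/
theorem IsVoteProfile.infVoteOne_eq_supVoteOne [hΘ : Θ.OrdConnected]
    (hV : IsVoteProfile p T t g V) (hg : IsRegularProfile p T t g) (f : UnilateralHypotheses Θ) :
    infVoteOne V f = supVoteOne V f := by
  by_cases hlo : t ∈ lowerNull p T f.zero
  · rw [hV.infVoteOne_of_mem_lowerNull hlo, hV.supVoteOne_of_mem_lowerNull hlo]
  by_cases hup : t ∈ upperNull p T f.one
  · rw [hV.infVoteOne_of_mem_upperNull hup, hV.supVoteOne_of_mem_upperNull hup]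
  have : Nonempty f.one := f.one_nonempty.to_subtype
  have : Nonempty f.zero := f.zero_nonempty.to_subtype
  obtain ⟨a, ⟨h1, h0⟩ | ⟨h1, h0⟩⟩ := f.exists_eq_Iic_or_Iio
  · rw [hV.supVoteOne_of_one_eq_Iic h1 hlo, infVoteOne]
    congr 1
    refine le_antisymm (ciSup_le fun θ => ?_) (le_of_forall_lt fun v hv => ?_)
    · have : a < (θ : Θ) := (h0 ▸ θ.2 : (θ : Θ) ∈ Ioi a)
      rw [hV.vote_eq f hlo hup, sub_sub_cancel]
      exact hV.antitone this.le
    -- The supremum of `g` over `θ > a` need not be attained; right-continuity makes it equal to `g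
    -- a`.
    · obtain ⟨b, c, _, hab, hvb, -⟩ := hg.exists_gt_lt (h0 ▸ hlo) hv
      have hb : b ∈ f.zero := h0 ▸ hab
      refine lt_of_lt_of_le ?_ (le_ciSup (hV.bddAbove_one_sub_vote f) ⟨b, hb⟩)
      rwa [hV.vote_eq f hlo hup, sub_sub_cancel]
  · rw [hV.infVoteOne_of_zero_eq_Ici h0 hup, supVoteOne]
    refine le_antisymm (le_of_forall_lt fun v hv => ?_) (ciSup_le fun θ => ?_)
    · obtain ⟨b, c, _, hba, hvb, -⟩ := hg.exists_lt_gt (v := 1 - v) (h1 ▸ hup) (by linarith)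
      have hb : b ∈ f.one := h1 ▸ hba
      refine lt_of_lt_of_le ?_ (le_ciSup (hV.bddAbove_vote f) ⟨b, hb⟩)
      rw [hV.vote_eq f hlo hup]
      linarith
    · have : (θ : Θ) < a := (h1 ▸ θ.2 : (θ : Θ) ∈ Iio a)
      rw [hV.vote_eq f hlo hup]
      linarith [hV.antitone this.le]

/-- Under the regularity conditions the votes have a quantile function. -/
theorem IsVoteProfile.exists_quantile [hΘ : Θ.OrdConnected] (hne : Nonempty Θ)
    (hV : IsVoteProfile p T t g V) (hg : IsRegularProfile p T t g) {u : ℝ} (hu : u ∈ Ioo 0 1) :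
    ∃ θ, ∀ f, (u < supVoteOne V f → θ ∈ f.one) ∧ (supVoteOne V f < u → θ ∈ f.zero) := by
  by_contra hcon
  -- Parameters too low to be a `u`-quantile. If there is no quantile, every other parameter is too
  -- high, and `Θ` splits into these two classes; regularity then contradicts each possible form of
  -- the split.
  set S : Set Θ := {θ | ∃ f : UnilateralHypotheses Θ, supVoteOne V f < u ∧ θ ∈ f.one} with hSdef
  have hS : IsLowerSet S := fun a b hba ⟨f, hf, ha⟩ => ⟨f, hf, f.isLowerSet_one hba ha⟩
  have hU : ∀ θ ∉ S, ∃ f : UnilateralHypotheses Θ, u < supVoteOne V f ∧ θ ∈ f.zero := by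
    intro θ hθ
    push Not at hcon
    obtain ⟨f, hf⟩ := hcon θ
    by_cases h1 : u < supVoteOne V f ∧ θ ∉ f.one
    · exact ⟨f, h1.1, f.notMem_one_iff.1 h1.2⟩
    · push Not at h1
      obtain ⟨h2, h3⟩ := hf h1
      refine absurd ⟨f, h2, ?_⟩ hθ
      by_contra h4
      exact h3 (f.notMem_one_iff.1 h4)
  have hlt : ∀ b c : Θ, ∀ hbc : b < c, t ∉ lowerNull p T (Ioi b) → 1 - g b < u → b ∈ S :=
    fun b c hbc hb hgb => ⟨.ofIic hbc, by
      rwa [hV.supVoteOne_of_one_eq_Iic (UnilateralHypotheses.ofIic_one hbc) (by simpa using hb)],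
      self_mem_Iic⟩
  have hgt : ∀ b c : Θ, ∀ hcb : c < b, t ∉ upperNull p T (Iio b) → u < 1 - g b → b ∉ S := by
    rintro b c hcb hb hgb ⟨f, hf, hbf⟩
    -- The vote on `{θ < b}` is known exactly only in its infimum form, so the equality of the two
    -- votes is used; monotonicity then excludes a cut containing `b` with vote below `u`.
    have h1 : u < supVoteOne V (.ofIio hcb) := by
      rwa [← hV.infVoteOne_eq_supVoteOne hg,
        hV.infVoteOne_of_zero_eq_Ici (UnilateralHypotheses.ofIio_zero hcb) (by simpa using hb)]
    refine absurd (hV.supVoteOne_mono (f := .ofIio hcb) (f' := f) fun θ hθ => ?_) (by linarith)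
    exact f.isLowerSet_one (le_of_lt hθ) hbf
  rcases S.eq_empty_or_nonempty with hSe | hSne
  · have hall : ∀ θ, θ ∉ S := fun θ => hSe ▸ notMem_empty θ
    by_cases hmin : ∃ a, IsLeast Θ a
    · obtain ⟨a, ha⟩ := hmin
      obtain ⟨f, -, hf⟩ := hU ⟨a, ha.1⟩ (hall _)
      obtain ⟨b, hb⟩ := f.one_nonempty
      exact absurd (ha.2 b.2) (not_le.2 (f.lt b hb _ hf))
    -- The limit `1` of `g` at the lower end makes some vote on `{θ ≤ b}` smaller than `u`. Taking
    -- `b` below the witness `c` keeps `t` out of the degenerate zone.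
    · obtain ⟨c, -, hc⟩ := exists_notMem_lowerNull (notMem_lowerNull_univ hV.notMem_nullPoints)
      obtain ⟨d, hd⟩ := exists_lt_of_not_isLeast fun h => hmin ⟨c, h⟩
      obtain ⟨b, hb1, hb2⟩ := (((hg.tendsto_inf hmin).eventually
        (lt_mem_nhds (show 1 - u < 1 by linarith [hu.1]))).and (eventually_le_atBot d)).exists
      exact hall b (hlt b c (lt_of_le_of_lt hb2 hd) (hc _ (lt_of_le_of_lt hb2 hd)) (by linarith))
  rcases Sᶜ.eq_empty_or_nonempty with hUe | hUne
  · have hall : ∀ θ, θ ∈ S := fun θ => (compl_empty_iff.1 hUe) ▸ mem_univ θ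
    by_cases hmax : ∃ a, IsGreatest Θ a
    · obtain ⟨a, ha⟩ := hmax
      obtain ⟨f, -, hf⟩ := hall ⟨a, ha.1⟩
      obtain ⟨b, hb⟩ := f.zero_nonempty
      exact absurd (ha.2 b.2) (not_le.2 (f.lt _ hf b hb))
    · obtain ⟨c, -, hc⟩ := exists_notMem_upperNull (notMem_upperNull_univ hV.notMem_nullPoints)
      obtain ⟨d, hd⟩ := exists_gt_of_not_isGreatest fun h => hmax ⟨c, h⟩
      obtain ⟨b, hb1, hb2⟩ := (((hg.tendsto_sup hmax).eventually
        (gt_mem_nhds (show 0 < 1 - u by linarith [hu.2]))).and (eventually_ge_atTop d)).exists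
      exact hgt b c (lt_of_lt_of_le hd hb2) (hc _ (lt_of_lt_of_le hd hb2)) (by linarith) (hall b)
  obtain ⟨a, ⟨h1, h0⟩ | ⟨h1, h0⟩⟩ :=
    (UnilateralHypotheses.ofLowerSet S hS hSne hUne).exists_eq_Iic_or_Iio
  · change S = Iic a at h1
    obtain ⟨f, hf, haf⟩ : a ∈ S := h1 ▸ self_mem_Iic
    have hfa : f.one = Iic a := Subset.antisymm
      (fun θ hθ => h1 ▸ (⟨f, hf, hθ⟩ : θ ∈ S)) fun θ hθ => f.isLowerSet_one hθ haf
    have hfa0 : f.zero = Ioi a := by rw [f.zero_eq_compl, hfa, compl_Iic]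
    have hlo : t ∉ lowerNull p T f.zero := fun h => by
      rw [hV.supVoteOne_of_mem_lowerNull h] at hf
      linarith [hu.2]
    rw [hV.supVoteOne_of_one_eq_Iic hfa hlo] at hf
    -- The cut at `a` has vote `1 - g a < u`; right-continuity propagates this strict inequality to
    -- some `b > a`, which would then also be too low.
    obtain ⟨b, c, hbc, hab, hvb, hb⟩ :=
      hg.exists_gt_lt (a := a) (v := 1 - u) (hfa0 ▸ hlo) (by linarith)
    have hbS := hlt b c hbc hb (by linarith)
    rw [h1] at hbS
    exact absurd hab (not_lt.2 hbS)
  · change S = Iio a at h1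
    obtain ⟨f, hf, haf⟩ := hU a (h1 ▸ self_notMem_Iio)
    have hfa : f.one = Iio a := by
      refine Subset.antisymm (fun θ hθ => f.lt θ hθ a haf) fun θ hθ => ?_
      obtain ⟨f', hf', hθ'⟩ : θ ∈ S := h1 ▸ hθ
      by_contra hθf
      refine absurd (hV.supVoteOne_mono (f := f) (f' := f') fun θ₁ hθ₁ => ?_) (by linarith)
      exact f'.isLowerSet_one (f.lt _ hθ₁ _ (f.notMem_one_iff.1 hθf)).le hθ'
    have hfa0 : f.zero = Ici a := by rw [f.zero_eq_compl, hfa, compl_Iio]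
    have hup : t ∉ upperNull p T f.one := fun h => by
      rw [hV.supVoteOne_of_mem_upperNull h] at hf
      linarith [hu.1]
    rw [← hV.infVoteOne_eq_supVoteOne hg, hV.infVoteOne_of_zero_eq_Ici hfa0 hup] at hf
    -- Symmetrically, left-continuity propagates `1 - g a > u` to some `b < a`, which lies in `S`
    -- and yet cannot.
    obtain ⟨b, c, hcb, hba, hvb, hb⟩ :=
      hg.exists_lt_gt (a := a) (v := 1 - u) (hfa ▸ hup) (by linarith)
    exact hgt b c hcb hb (by linarith) (h1 ▸ hba)

theorem IsVoteProfile.exists_extension [hΘ : Θ.OrdConnected] (hne : Nonempty Θ)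
    (hV : IsVoteProfile p T t g V) (hg : IsRegularProfile p T t g) :
    ∃ ν, IsProbabilityExtension (supVoteOne V) ν :=
  exists_isProbabilityExtension hV.supVoteOne_mem_Icc fun _ hu => hV.exists_quantile hne hg hu

end Regular

/-! ### From compatibility to regularity. -/

theorem _root_.Antitone.continuousWithinAt_Ici {α : Type*} [LinearOrder α] [TopologicalSpace α]
    [OrderTopology α] {g : α → ℝ} (hg : Antitone g) {a : α} (h : ∀ v < g a, ∃ b > a, v < g b) :
    ContinuousWithinAt g (Ici a) a := by
  refine tendsto_order.2 ⟨fun v hv => ?_, fun v hv => ?_⟩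
  · obtain ⟨b, hab, hb⟩ := h v hv
    filter_upwards [nhdsWithin_le_nhds (Iio_mem_nhds hab)] with θ hθ
    exact hb.trans_le (hg (le_of_lt hθ))
  · filter_upwards [self_mem_nhdsWithin] with θ hθ
    exact (hg hθ).trans_lt hv

theorem _root_.Antitone.continuousWithinAt_Iic {α : Type*} [LinearOrder α] [TopologicalSpace α]
    [OrderTopology α] {g : α → ℝ} (hg : Antitone g) {a : α} (h : ∀ v > g a, ∃ b < a, g b < v) :
    ContinuousWithinAt g (Iic a) a := by
  refine tendsto_order.2 ⟨fun v hv => ?_, fun v hv => ?_⟩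
  · filter_upwards [self_mem_nhdsWithin] with θ hθ
    exact hv.trans_le (hg hθ)
  · obtain ⟨b, hba, hb⟩ := h v hv
    filter_upwards [nhdsWithin_le_nhds (Ioi_mem_nhds hba)] with θ hθ
    exact (hg (le_of_lt hθ)).trans_lt hb

section Compatible

variable {Ω : Type*} {Θ : Set ℝ} {p : Θ → Ω → ℝ≥0} {T : Ω → ℝ} {t : ℝ} {g : Θ → ℝ}
  {V : UnilateralHypotheses Θ → Θ → ℝ}

theorem IsVoteProfile.supVoteOne_ofIic (hV : IsVoteProfile p T t g V) {b c : Θ} (hbc : b < c)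
    (hc : ∀ B : Set Θ, c ∈ B → t ∉ lowerNull p T B) : supVoteOne V (.ofIic hbc) = 1 - g b :=
  hV.supVoteOne_of_one_eq_Iic (UnilateralHypotheses.ofIic_one hbc)
    (hc _ (by rw [UnilateralHypotheses.ofIic_zero]; exact hbc))

theorem IsVoteProfile.infVoteOne_ofIio (hV : IsVoteProfile p T t g V) {b c : Θ} (hcb : c < b)
    (hc : ∀ B : Set Θ, c ∈ B → t ∉ upperNull p T B) : infVoteOne V (.ofIio hcb) = 1 - g b :=
  hV.infVoteOne_of_zero_eq_Ici (UnilateralHypotheses.ofIio_zero hcb)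
    (hc _ (by rw [UnilateralHypotheses.ofIio_one]; exact hcb))

theorem IsVoteProfile.right_continuous [hΘ : Θ.OrdConnected] (hV : IsVoteProfile p T t g V)
    (h1 : IsCompatibleAt (supVoteOne V)) {a : Θ} (ha : t ∉ lowerNull p T {θ | a < θ}) :
    ContinuousWithinAt g (Ici a) a := by
  refine hV.antitone.continuousWithinAt_Ici fun v hv => ?_
  by_contra! hcon
  obtain ⟨c, hac, hc⟩ := exists_notMem_lowerNull ha
  replace hac : a < c := hac
  obtain ⟨u, hu, huI, hut⟩ := exists_seq_strictAnti_tendsto' hac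
  -- The constant cut `{θ ≤ a}` is compared with cuts `{θ ≤ u n}` decreasing to it. A jump of `g` to
  -- the right of `a` would separate the two limits.
  obtain ⟨l, hl, hl'⟩ := h1.same_limit (fun _ => .ofIic hac) (fun n => .ofIic (huI n).2)
    monotone_const (fun m n hmn => Iic_subset_Iic.2 (hu.antitone hmn)) (by
      ext θ
      simp only [UnilateralHypotheses.ofIic_one, iUnion_const, mem_iInter, mem_Iic]
      exact ⟨fun h n => h.trans (huI n).1.le, fun h => ge_of_tendsto' hut h⟩)
  rw [hV.supVoteOne_ofIic hac hc] at hl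
  have hl1 := tendsto_nhds_unique hl tendsto_const_nhds
  have hl2 : 1 - v ≤ l := ge_of_tendsto' hl' fun n => by
    rw [hV.supVoteOne_ofIic _ hc]
    linarith [hcon _ (huI n).1]
  linarith

theorem IsVoteProfile.left_continuous [hΘ : Θ.OrdConnected] (hV : IsVoteProfile p T t g V)
    (h0 : IsCompatibleAt (infVoteOne V)) {a : Θ} (ha : t ∉ upperNull p T {θ | θ < a}) :
    ContinuousWithinAt g (Iic a) a := by
  refine hV.antitone.continuousWithinAt_Iic fun v hv => ?_
  by_contra! hcon
  obtain ⟨c, hca, hc⟩ := exists_notMem_upperNull ha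
  replace hca : c < a := hca
  obtain ⟨u, hu, huI, hut⟩ := exists_seq_strictMono_tendsto' hca
  -- Cuts `{θ < u n}` increase to the constant cut `{θ < a}`; the infimum form of the vote reads off
  -- `g` exactly on such cuts.
  obtain ⟨l, hl, hl'⟩ := h0.same_limit (fun n => .ofIio (huI n).1) (fun _ => .ofIio hca)
    (fun m n hmn => Iio_subset_Iio (hu.monotone hmn)) antitone_const (by
      ext θ
      simp only [UnilateralHypotheses.ofIio_one, iInter_const, mem_iUnion, mem_Iio]
      exact ⟨fun ⟨n, h⟩ => h.trans (huI n).2,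
        fun h => (hut.eventually (lt_mem_nhds h)).exists⟩)
  rw [hV.infVoteOne_ofIio hca hc] at hl'
  have hl1 := tendsto_nhds_unique hl' tendsto_const_nhds
  have hl2 : l ≤ 1 - v := le_of_tendsto' hl fun n => by
    rw [hV.infVoteOne_ofIio _ hc]
    linarith [hcon _ (huI n).2]
  linarith

theorem IsVoteProfile.tendsto_atBot [hΘ : Θ.OrdConnected] (hV : IsVoteProfile p T t g V)
    (h1 : IsCompatibleAt (supVoteOne V)) (hmin : ¬ ∃ a, IsLeast Θ a) :
    Tendsto g atBot (𝓝 1) := by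
  refine tendsto_order.2 ⟨fun v hv => ?_, fun v hv =>
    Eventually.of_forall fun θ => (hV.mem_Icc θ).2.trans_lt hv⟩
  suffices h : ∃ b, v < g b by
    obtain ⟨b, hb⟩ := h
    filter_upwards [eventually_le_atBot b] with θ hθ
    exact hb.trans_le (hV.antitone hθ)
  by_contra! hcon
  have hlt : ∀ θ : Θ, ∃ b, b < θ := fun θ => exists_lt_of_not_isLeast fun h => hmin ⟨θ, h⟩
  obtain ⟨c, -, hc⟩ := exists_notMem_lowerNull (notMem_lowerNull_univ hV.notMem_nullPoints)
  obtain ⟨d, hd⟩ := hlt c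
  have : Nonempty Θ := ⟨c⟩
  obtain ⟨u, hu, hut⟩ := exists_seq_antitone_tendsto_atTop_atBot Θ
  -- Truncation at `d < c` makes every cut nontrivial and leaves `c` in its upper part, so the
  -- formula `1 - g` applies to all terms.
  have huc : ∀ n, min (u n) d < c := fun n => (min_le_right _ _).trans_lt hd
  have hlim := h1.tendsto_zero (fun n => .ofIic (huc n))
    (fun m n hmn => Iic_subset_Iic.2 (min_le_min_right d (hu hmn))) (by
      refine eq_empty_of_forall_notMem fun θ hθ => ?_
      simp only [UnilateralHypotheses.ofIic_one, mem_iInter, mem_Iic] at hθ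
      obtain ⟨b, hb⟩ := hlt θ
      obtain ⟨n, hn⟩ := (hut.eventually (eventually_le_atBot b)).exists
      exact absurd ((hθ n).trans ((min_le_left _ _).trans hn)) (not_le.2 hb))
  have : 1 - v ≤ 0 := ge_of_tendsto' hlim fun n => by
    rw [hV.supVoteOne_ofIic _ hc]
    linarith [hcon (min (u n) d)]
  linarith

theorem IsVoteProfile.tendsto_atTop [hΘ : Θ.OrdConnected] (hV : IsVoteProfile p T t g V)
    (h0 : IsCompatibleAt (infVoteOne V)) (hmax : ¬ ∃ b, IsGreatest Θ b) :
    Tendsto g atTop (𝓝 0) := by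
  refine tendsto_order.2 ⟨fun v hv =>
    Eventually.of_forall fun θ => hv.trans_le (hV.mem_Icc θ).1, fun v hv => ?_⟩
  suffices h : ∃ b, g b < v by
    obtain ⟨b, hb⟩ := h
    filter_upwards [eventually_ge_atTop b] with θ hθ
    exact (hV.antitone hθ).trans_lt hb
  by_contra! hcon
  have hgt : ∀ θ : Θ, ∃ b, θ < b := fun θ => exists_gt_of_not_isGreatest fun h => hmax ⟨θ, h⟩
  obtain ⟨c, -, hc⟩ := exists_notMem_upperNull (notMem_upperNull_univ hV.notMem_nullPoints)
  obtain ⟨d, hd⟩ := hgt c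
  have : Nonempty Θ := ⟨c⟩
  obtain ⟨u, hu, hut⟩ := exists_seq_monotone_tendsto_atTop_atTop Θ
  have huc : ∀ n, c < max (u n) d := fun n => hd.trans_le (le_max_right _ _)
  have hlim := h0.tendsto_one (fun n => .ofIio (huc n))
    (fun m n hmn => Iio_subset_Iio (max_le_max_right d (hu hmn))) (by
      refine eq_univ_of_forall fun θ => ?_
      simp only [UnilateralHypotheses.ofIio_one, mem_iUnion, mem_Iio]
      obtain ⟨b, hb⟩ := hgt θ
      obtain ⟨n, hn⟩ := (hut.eventually (eventually_ge_atTop b)).exists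
      exact ⟨n, hb.trans_le (hn.trans (le_max_left _ _))⟩)
  have : 1 ≤ 1 - v := le_of_tendsto' hlim fun n => by
    rw [hV.infVoteOne_ofIio _ hc]
    linarith [hcon (max (u n) d)]
  linarith

/-- At a point where some density does not vanish, compatibility of both most favourable votes is
equivalent to the regularity conditions. -/
theorem IsVoteProfile.isCompatibleAt_iff [hΘ : Θ.OrdConnected] (hne : Nonempty Θ)
    (hV : IsVoteProfile p T t g V) :
    IsCompatibleAt (supVoteOne V) ∧ IsCompatibleAt (infVoteOne V) ↔ IsRegularProfile p T t g := by
  refine ⟨fun ⟨h1, h0⟩ => ⟨fun _ _ ha => hV.right_continuous h1 ha,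
    fun _ _ ha => hV.left_continuous h0 ha, hV.tendsto_atBot h1, hV.tendsto_atTop h0⟩,
    fun hg => ?_⟩
  obtain ⟨ν, hν⟩ := hV.exists_extension hne hg
  rw [show infVoteOne V = supVoteOne V from funext (hV.infVoteOne_eq_supVoteOne hg), and_self]
  exact hν.isCompatibleAt

end Compatible

end ExpertVotes

/-! ### Passage from one realisation to almost every realisation. -/

open ExpertVotes in
theorem proposition5p2p3 {Ω : Type*} [MeasurableSpace Ω] (μ : Measure Ω)
    (Θ : Set ℝ) (hΘ : Θ.OrdConnected) (p : Θ → Ω → ℝ≥0) (hp : IsDominatedModel μ p)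
    (T : Ω → ℝ) (hT : Measurable T) (hMLR : IsMLR p T)
    (h : UnilateralHypotheses Θ → Θ → Θ → ℝ → ℝ≥0∞)
    (hh : ∀ f, IsNormalizedFamily p T f (h f))
    (K : ℝ → EReal) (hK : IsGlobalEssential μ p T h K) :
    ((AreCompatibleVotes μ p (mostFavorableOne μ p T h) ∧
        AreCompatibleVotes μ p (mostFavorableZero μ p T h)) ↔
      ModelAE μ p (fun ω => RegularAt μ p T K (T ω))) ∧
    (ModelAE μ p (fun ω => RegularAt μ p T K (T ω)) →
      ModelAE μ p (fun ω => ∃ ν : Measure Θ,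
        (∀ ν' : Measure Θ, IsProbabilityExtension (mostFavorableOne μ p T h ω) ν' ↔ ν' = ν) ∧
        (∀ ν' : Measure Θ, IsProbabilityExtension (mostFavorableZero μ p T h ω) ν' ↔ ν' = ν))) := by
  set V : Ω → UnilateralHypotheses Θ → Θ → ℝ := fun ω f θ =>
    voteOne (law μ p θ) T (experts f (h f)) ω
  have hV : ∀ θ, ∀ᵐ ω ∂(law μ p θ), IsVoteProfile p T (T ω) (meanCDFAt μ p T K (T ω)) (V ω) := by
    intro θ
    filter_upwards [hp.ae_density_ne_zero θ] with ω hω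
    -- Under `P_θ` the density `p θ` is almost surely nonzero, so `T ω` almost surely avoids `N`.
    exact isVoteProfile hp hT hMLR hh hK fun hN => hω (hN ω rfl θ)
  have hreg : ∀ ω, RegularAt μ p T K (T ω) ↔
      IsRegularProfile p T (T ω) (meanCDFAt μ p T K (T ω)) := fun ω =>
    ⟨fun H => ⟨H.1, H.2, H.3, H.4⟩, fun H => ⟨H.1, H.2, H.3, H.4⟩⟩
  have hone : ∀ ω, mostFavorableOne μ p T h ω = supVoteOne (V ω) := fun ω => rfl
  have hzero : ∀ ω, mostFavorableZero μ p T h ω = infVoteOne (V ω) := fun ω => rfl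
  simp only [AreCompatibleVotes, ModelAE, hone, hzero, hreg]
  refine ⟨⟨fun ⟨h1, h0⟩ θ => ?_, fun H => ⟨fun θ => ?_, fun θ => ?_⟩⟩, fun H θ => ?_⟩
  · filter_upwards [hV θ, h1 θ, h0 θ] with ω hω hω1 hω0
    exact (hω.isCompatibleAt_iff ⟨θ⟩).1 ⟨hω1, hω0⟩
  · filter_upwards [hV θ, H θ] with ω hω hg
    exact ((hω.isCompatibleAt_iff ⟨θ⟩).2 hg).1
  · filter_upwards [hV θ, H θ] with ω hω hg
    exact ((hω.isCompatibleAt_iff ⟨θ⟩).2 hg).2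
  · filter_upwards [hV θ, H θ] with ω hω hg
    obtain ⟨ν, hν⟩ := hω.exists_extension ⟨θ⟩ hg
    rw [show infVoteOne (V ω) = supVoteOne (V ω) from funext (hω.infVoteOne_eq_supVoteOne hg)]
    have hiff : ∀ ν' : Measure Θ, IsProbabilityExtension (supVoteOne (V ω)) ν' ↔ ν' = ν :=
      fun ν' => ⟨fun h' => h'.unique hν, fun h' => h' ▸ hν⟩
    exact ⟨ν, hiff, hiff⟩
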